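/- **Setup.** Let $\sigma_0=I,\sigma_1=X,\sigma_2=Y,\sigma_3=Z$ be the Pauli matrices and $\sigma_{\mathbf i}=\sigma_{i_1}\otimes\cdots\otimes\sigma_{i_N}$ for $\mathbf i\in\{0,1,2,3\}^N$. Let $H=\sum_{\mathbf i\in\mathcal N}\sigma_{\mathbf i}$, where $\mathcal N$ is a set of vectors $\mathbf i$ having at least $1$ and at most $S$ nonzero entries. We say that $H$ acts on qubit $n$ if $i_n\ne0$ for some $\mathbf i\in\mathcal N$. Consider the circuit $U(\boldsymbol\theta)=U_L\cdots U_1$ with blocks $$U_l=\Big(\bigotimes_{n=1}^N e^{-\frac i2\theta_{2l,n}Y}\Big)\Big(\bigotimes_{n=1}^N e^{-\frac i2\theta_{2l-1,n}X}\Big)\mathrm{CZ}_l ,$$ where $\mathrm{CZ}_l$ is an arbitrary (possibly empty) product of controlled-$Z$ gates on pairs of distinct qubits, and the cost function $C(\boldsymbol\theta)=\mathrm{Tr}\big[H\,U(\boldsymbol\theta)\,|0\cdots0\rangle\langle0\cdots0|\,U(\boldsymbol\theta)^\dagger\big]$. The $2LN$ parameters $\theta_{q,n}$ ($q\in[2L]$,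 $n\in[N]$) are independent and uniform on $[-a\pi,a\pi]$, where $0<a<1$; $\mathbb E$ and $\mathrm{Var}$ refer to this law. Put $$\alpha=\tfrac14\Big(2+\frac{\sin 2a\pi}{a\pi}\Big),\qquad \beta=\tfrac14\Big(2-\frac{\sin 2a\pi}{a\pi}\Big).$$ **Theorem.** 1. For all $q\in[2L]$ and $n\in[N]$ the partial derivative $\partial_{\theta_{q,n}}C$ exists everywhere and is square integrable. For every $q\in[2L-2]$ and every qubit $n$ on which $H$ acts, $$\mathbb E\big(\partial_{\theta_{q,n}}C\big)^2\ \ge\ \alpha^{2SL-1}\beta^{S+1}.$$ 2. If no $\mathbf i\in\mathcal N$ has exactly one entry in $\{1,2\}$, then $\mathbb E\,\partial_{\theta_{q,n}}C=0$ for all $q\in[2L]$, $n\in[N]$; consequently, for every $q\in[2L-2]$ and every qubit $n$ on which $H$ acts, $$\mathrm{Var}\,\partial_{\theta_{q,n}}C\ \ge\ \alpha^{2SL-1}\beta^{S+1}.$$ 3. For $S\ge1$ and $L\ge2$ the equation $$\frac{\sin 2a\pi}{2a\pi}=\frac{S(2L-1)-2}{S(2L+1)}$$ has exactly one solution $a=a_{S,L}\in(0,1)$,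 and for fixed $S$ one has $a_{S,L}\in\Theta(1/\sqrt L)$ as $L\to\infty$. If the parameters are initialized with $a=a_{S,L}$, then for every $q\in[2L-2]$ and every qubit $n$ on which $H$ acts, $$\mathbb E\big(\partial_{\theta_{q,n}}C\big)^2\ \ge\ \Big(\frac{S+1}{eS}\Big)^{S+1}\frac1{(2L+1)^{S+1}} .$$ 4. (No barren plateau.) Fix $S$ and consider a sequence of such problems, indexed by $k\in\mathbb N$, with $N_k$ qubits and $L_k$ blocks, initialized with $a=a_{S,L_k}$, together with parameters $\theta_{q_k,n_k}$ such that $q_k\in[2L_k-2]$ and the $k$-th Hamiltonian acts on qubit $n_k$. Let $m_k\to\infty$ be natural numbers measuring the size (for example $m_k=N_k$ or $m_k=L_k$), and suppose $L_k\le p(m_k)$ for some polynomial $p$ with coefficients in $\mathbb N$. Then, as $k\to\infty$, $\mathbb E(\partial_{\theta_{q_k,n_k}}C_k)^2\in\Omega(1/\mathrm{poly}(m_k))$, and there is no barren plateau in these directions: it is not the case that $\mathbb E\,\partial_{\theta_{q_k,n_k}}C_k=0$ for all $k$ and $\mathrm{Var}\,\partial_{\theta_{q_k,n_k}}C_k\in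 O(b^{m_k})$ for some $b\in(0,1)$. If moreover the condition in part 2 holds for every $k$, then also $\mathrm{Var}\,\partial_{\theta_{q_k,n_k}}C_k\in\Omega(1/\mathrm{poly}(m_k))$. -/

import Mathlib

open MeasureTheory Filter Asymptotics
open scoped Matrix

noncomputable section

namespace ReducedDomainVQE

/-! ### Pauli strings, rotation layers, entanglement layers -/

/-- Operators on `N` qubits: matrices indexed by the computational basis `{0,1}^N`. -/
abbrev Operator (N : ℕ) : Type := Matrix (Fin N → Fin 2) (Fin N → Fin 2) ℂ

/-- The Pauli matrices `σ₀ = I`, `σ₁ = X`, `σ₂ = Y`, `σ₃ = Z`. -/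
def pauli : Fin 4 → Matrix (Fin 2) (Fin 2) ℂ :=
  ![!![1, 0; 0, 1], !![0, 1; 1, 0], !![0, -Complex.I; Complex.I, 0], !![1, 0; 0, -1]]

/-- The tensor product `A₁ ⊗ ⋯ ⊗ A_N` of one-qubit operators. -/
def tensor {N : ℕ} (A : Fin N → Matrix (Fin 2) (Fin 2) ℂ) : Operator N :=
  Matrix.of fun x y => ∏ j, A j (x j) (y j)

/-- The Pauli string `σ_i = σ_{i₁} ⊗ ⋯ ⊗ σ_{i_N}`. -/
def pauliString {N : ℕ} (i : Fin N → Fin 4) : Operator N :=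
  tensor fun j => pauli (i j)

/-- The locality of a Pauli string: its number of non-identity tensor factors. -/
def locality {N : ℕ} (i : Fin N → Fin 4) : ℕ :=
  (Finset.univ.filter fun j => i j ≠ 0).card

/-- The number of tensor factors of a Pauli string that are `X` or `Y`. -/
def countXY {N : ℕ} (i : Fin N → Fin 4) : ℕ :=
  (Finset.univ.filter fun j => i j = 1 ∨ i j = 2).card

/-- The one-qubit rotation `e^{-i (t/2) G}`. -/
def pauliRotation (G : Matrix (Fin 2) (Fin 2) ℂ) (t : ℝ) : Matrix (Fin 2) (Fin 2) ℂ :=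
  NormedSpace.exp ((-(Complex.I * ((t / 2 : ℝ) : ℂ))) • G)

/-- The layer `e^{-i (t₁/2) G} ⊗ ⋯ ⊗ e^{-i (t_N/2) G}`. -/
def rotationLayer {N : ℕ} (G : Matrix (Fin 2) (Fin 2) ℂ) (t : Fin N → ℝ) : Operator N :=
  tensor fun j => pauliRotation G (t j)

/-- Pairs of distinct qubits. -/
abbrev QubitPair (N : ℕ) : Type := {p : Fin N × Fin N // p.1 ≠ p.2}

/-- The controlled-`Z` gate on a pair of qubits: the sign of a basis vector is flipped exactly if
both qubits are in state `1`. -/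
def czGate {N : ℕ} (p : QubitPair N) : Operator N :=
  Matrix.diagonal fun x => if x p.1.1 = 1 ∧ x p.1.2 = 1 then -1 else 1

/-- An entanglement layer: a product of arbitrarily many (possibly no) `CZ` gates. -/
def czLayer {N : ℕ} (E : List (QubitPair N)) : Operator N :=
  (E.map czGate).prod

/-! ### The VQE problem -/

/-- The data of a VQE problem with locality at most `S`: the number of qubits, the number of blocks
of the circuit, the entanglement layer of each block, and the set of Pauli strings whose sum is the
Hamiltonian, each of which has at least one and at most `S` non-identity factors. -/
structure Problem (S : ℕ) where
  qubits : ℕ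
  depth : ℕ
  layer : Fin depth → List (QubitPair qubits)
  terms : Finset (Fin qubits → Fin 4)
  local_terms : ∀ i ∈ terms, 1 ≤ locality i ∧ locality i ≤ S

namespace Problem

variable {S : ℕ} (V : Problem S)

/-- Parameter indices `(q, n)`: rotation layer and qubit. Layers are counted from `0` here, so that
`(q, n)` stands for the parameter of rotation layer number `q + 1`. -/
abbrev Index : Type := Fin (2 * V.depth) × Fin V.qubits

/-- The Hamiltonian, the sum of the Pauli strings in `terms`. -/
def hamiltonian : Operator V.qubits := ∑ i ∈ V.terms, pauliString i

/-- The `l`-th block: the entanglement layer, then `R_X` on each qubit, then `R_Y` on each qubit. -/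
def block (θ : V.Index → ℝ) (l : Fin V.depth) : Operator V.qubits :=
  rotationLayer (pauli 2) (fun n => θ (⟨2 * l + 1, by omega⟩, n)) *
    rotationLayer (pauli 1) (fun n => θ (⟨2 * l, by omega⟩, n)) *
      czLayer (V.layer l)

/-- The circuit `U(θ) = U_L ⋯ U_1`; the first block acts first, so it is the rightmost factor. -/
def circuit (θ : V.Index → ℝ) : Operator V.qubits :=
  (List.ofFn (V.block θ)).reverse.prod

/-- The initial state `|0⋯0⟩⟨0⋯0|`. -/
def initialState : Operator V.qubits := Matrix.single 0 0 1

/-- The cost function `C(θ) = Tr[H U(θ) ρ U(θ)†]` (the trace is a real number). -/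
def cost (θ : V.Index → ℝ) : ℝ :=
  (V.hamiltonian * V.circuit θ * V.initialState * (V.circuit θ)ᴴ).trace.re

/-- The partial derivative of the cost function with respect to the parameter `v`. -/
def partialCost (v : V.Index) (θ : V.Index → ℝ) : ℝ :=
  deriv (fun t => V.cost (Function.update θ v t)) (θ v)

/-- The law of the initial parameters: independent and uniform on `[-aπ, aπ]`. -/
def initialLaw (a : ℝ) : Measure (V.Index → ℝ) :=
  Measure.pi fun _ => ProbabilityTheory.cond volume (Set.Icc (-(a * Real.pi)) (a * Real.pi))

/-- The expectation of the partial derivative under the law of the initial parameters. -/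
def meanPartial (a : ℝ) (v : V.Index) : ℝ :=
  ∫ θ, V.partialCost v θ ∂V.initialLaw a

/-- The expectation of the square of the partial derivative. -/
def secondMomentPartial (a : ℝ) (v : V.Index) : ℝ :=
  ∫ θ, (V.partialCost v θ) ^ 2 ∂V.initialLaw a

/-- The variance of the partial derivative. -/
def variancePartial (a : ℝ) (v : V.Index) : ℝ :=
  ProbabilityTheory.variance (V.partialCost v) (V.initialLaw a)

/-- The Hamiltonian acts on qubit `n`: some Pauli string in it has a non-identity factor there. -/
def ActsOn (n : Fin V.qubits) : Prop := ∃ i ∈ V.terms, i n ≠ 0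

/-- No Pauli string of the Hamiltonian has exactly one factor in `{X, Y}`. -/
def NoSingleXY : Prop := ∀ i ∈ V.terms, countXY i ≠ 1

end Problem

/-! ### Constants and barren plateaus -/

/-- `α = (2 + sin(2aπ)/(aπ)) / 4`. -/
def alphaCoeff (a : ℝ) : ℝ := (2 + Real.sin (2 * a * Real.pi) / (a * Real.pi)) / 4

/-- `β = (2 - sin(2aπ)/(aπ)) / 4`. -/
def betaCoeff (a : ℝ) : ℝ := (2 - Real.sin (2 * a * Real.pi) / (a * Real.pi)) / 4

/-- `a ∈ (0,1)` solves `sin(2aπ)/(2aπ) = (S(2L-1) - 2)/(S(2L+1))`. -/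
def IsSelected (S L : ℕ) (a : ℝ) : Prop :=
  0 < a ∧ a < 1 ∧
    Real.sin (2 * a * Real.pi) / (2 * a * Real.pi) =
      ((S : ℝ) * (2 * (L : ℝ) - 1) - 2) / ((S : ℝ) * (2 * (L : ℝ) + 1))

/-- A sequence of random partial derivatives with the given means and variances exhibits a barren
plateau with respect to the sizes `m`: the means vanish and the variances decrease exponentially. -/
def BarrenPlateau (m : ℕ → ℕ) (mean var : ℕ → ℝ) : Prop :=
  (∀ k, mean k = 0) ∧
    ∃ b : ℝ, 0 < b ∧ b < 1 ∧ var =O[atTop] fun k => b ^ m k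

/-- The sequence `f` is in `Ω(1/poly(m))`. -/
def PolynomiallyLarge (m : ℕ → ℕ) (f : ℕ → ℝ) : Prop :=
  ∃ d : ℕ, (fun k => 1 / (m k : ℝ) ^ d) =O[atTop] f

end ReducedDomainVQE

end

open ReducedDomainVQE

/-! In the Heisenberg picture a `CZ` gate permutes Pauli strings up to sign. A rotation fixes a
factor commuting with its axis and otherwise mixes it with one partner, with coefficients cos and
sin. So the expectation of a string is the recursion `expect` in the weights (1, cos, sin) of the
angles (`trace_eq_expect`). Each angle occurs once, so differentiating in `v` only replaces the
weights of `v` by (0, -sin, cos) (`hasDerivAt_expect`).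

Second moments are integrated angle by angle. Moments odd in sin vanish, and what remains is the
recursion `pairMoment` (`integral_prod_mul_expect_mul_expect`). It vanishes unless the two strings
agree at every site up to exchanging I and Z, and then all signs cancel (`pairMoment_eq_zero`,
`pairMoment_nonneg`). All cross terms of the Hamiltonian are therefore nonnegative, and a single
diagonal term bounds the second moment from below.

For a string with s nontrivial factors, keep one path of the recursion. The last block turns every
nontrivial factor into Z at a cost of at least α²β per factor. The other L - 1 blocks keep each Z
with weight α per rotation, except that the differentiated rotation contributes β instead of α. The
product is α^(2sL-1) β^(s+1) (`derivMoment_ge`), which decreases in s ≤ S.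

The mean vanishes by symmetry: negating all angles on one qubit preserves the law and multiplies the
derivative by a sign, which is -1 for a suitable qubit (`integral_expect_derivWeight_eq_zero`). The
selected `a` maximizes α^(2SL-1) β^(S+1) subject to α + β = 1, which leaves a bound of order
(2L+1)^(-(S+1)). For depth polynomial in the size this cannot decay exponentially. -/

namespace ReducedDomainVQE

/-! ### One-parameter gates acting on Pauli strings -/

/-- The index of the Pauli matrix generating a rotation: `X` for `false`, `Y` for `true`. -/
def axis (g : Bool) : Fin 4 := if g then 2 else 1

/-- The Pauli matrices commuting with the generator. -/
def Fixed (g : Bool) (p : Fin 4) : Prop := p = 0 ∨ p = axis g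

instance (g : Bool) (p : Fin 4) : Decidable (Fixed g p) := by unfold Fixed; infer_instance

/-- The rotation about the axis `g` mixes a Pauli matrix `p` with `partner g p`. -/
def partner (g : Bool) : Fin 4 → Fin 4 := if g then ![0, 3, 2, 1] else ![0, 1, 3, 2]

/-- The sign with which `partner g p` occurs in the rotated `p`. -/
noncomputable def rotSign (g : Bool) : Fin 4 → ℝ := if g then ![0, 1, 0, -1] else ![0, 0, -1, 1]

/-- A Pauli matrix that is `X` or `Y`. -/
def IsXY (p : Fin 4) : Prop := p = 1 ∨ p = 2

instance (p : Fin 4) : Decidable (IsXY p) := by unfold IsXY; infer_instance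

/-- Multiplication of a Pauli matrix by `Z`, up to a phase. -/
def zMul : Fin 4 → Fin 4 := ![3, 2, 1, 0]

variable {N : ℕ}

/-- The Pauli string obtained, up to a sign, by conjugating with a `CZ` gate. -/
def czMap (p : QubitPair N) (i : Fin N → Fin 4) (n : Fin N) : Fin 4 :=
  if n = p.1.1 ∧ IsXY (i p.1.2) ∨ n = p.1.2 ∧ IsXY (i p.1.1) then zMul (i n) else i n

/-- The sign that a Pauli string picks up on conjugation with a `CZ` gate. -/
noncomputable def czSign (p : QubitPair N) (i : Fin N → Fin 4) : ℝ :=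
  if i p.1.1 = 1 ∧ i p.1.2 = 2 ∨ i p.1.1 = 2 ∧ i p.1.2 = 1 then -1 else 1

/-! ### Tensor products -/

theorem tensor_mul (A B : Fin N → Matrix (Fin 2) (Fin 2) ℂ) :
    tensor A * tensor B = tensor (fun j => A j * B j) := by
  ext x y
  simp only [tensor, Matrix.mul_apply, Matrix.of_apply, Finset.prod_univ_sum, Fintype.piFinset_univ,
    Finset.prod_mul_distrib]

theorem tensor_one : tensor (fun _ : Fin N => (1 : Matrix (Fin 2) (Fin 2) ℂ)) = 1 := by
  ext x y
  simp only [tensor, Matrix.of_apply, Matrix.one_apply]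
  by_cases h : x = y
  · simp [h]
  · obtain ⟨j, hj⟩ := Function.ne_iff.1 h
    rw [if_neg h]
    exact Finset.prod_eq_zero (Finset.mem_univ j) (by simp [hj])

theorem tensor_conjTranspose (A : Fin N → Matrix (Fin 2) (Fin 2) ℂ) :
    (tensor A)ᴴ = tensor (fun j => (A j)ᴴ) := by
  ext x y
  simp [tensor, Matrix.conjTranspose_apply]

theorem tensor_update_apply (A : Fin N → Matrix (Fin 2) (Fin 2) ℂ) (n : Fin N)
    (B : Matrix (Fin 2) (Fin 2) ℂ) (x y : Fin N → Fin 2) :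
    tensor (Function.update A n B) x y =
      B (x n) (y n) * ∏ j ∈ Finset.univ \ {n}, A j (x j) (y j) := by
  simp only [tensor, Matrix.of_apply]
  rw [← Finset.prod_update_of_mem (Finset.mem_univ n)]
  refine Finset.prod_congr rfl fun j _ => ?_
  by_cases h : j = n
  · subst h; simp
  · simp [h]

theorem tensor_update_add (A : Fin N → Matrix (Fin 2) (Fin 2) ℂ) (n : Fin N)
    (B C : Matrix (Fin 2) (Fin 2) ℂ) (b c : ℂ) :
    tensor (Function.update A n (b • B + c • C)) =
      b • tensor (Function.update A n B) + c • tensor (Function.update A n C) := by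
  ext x y
  simp only [Matrix.add_apply, Matrix.smul_apply, tensor_update_apply, smul_eq_mul]
  ring

theorem pauliString_update (i : Fin N → Fin 4) (n : Fin N) (p : Fin 4) :
    pauliString (Function.update i n p) =
      tensor (Function.update (fun j => pauli (i j)) n (pauli p)) := by
  unfold pauliString
  congr 1
  funext j
  by_cases h : j = n
  · subst h; simp
  · simp [h]

/-- The operator acting as `B` on qubit `n` and trivially elsewhere. -/
noncomputable def single (n : Fin N) (B : Matrix (Fin 2) (Fin 2) ℂ) : Operator N :=
  tensor (Function.update (fun _ => 1) n B)

/-- Splits a rotation layer into one-qubit gates, so that later recursions meet one parameter at a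
time. -/
theorem prod_single_eq_tensor (A : Fin N → Matrix (Fin 2) (Fin 2) ℂ) (l : List (Fin N))
    (hl : l.Nodup) :
    (l.map fun n => single n (A n)).prod = tensor (fun j => if j ∈ l then A j else 1) := by
  induction l with
  | nil => simp [tensor_one]
  | cons n l ih =>
    rw [List.nodup_cons] at hl
    rw [List.map_cons, List.prod_cons, ih hl.2, single, tensor_mul]
    congr 1
    funext j
    by_cases h : j = n
    · subst h; simp [hl.1]
    · simp [h]

theorem single_conj (i : Fin N → Fin 4) (n : Fin N) (B : Matrix (Fin 2) (Fin 2) ℂ) :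
    (single n B)ᴴ * pauliString i * single n B =
      tensor (Function.update (fun j => pauli (i j)) n (Bᴴ * pauli (i n) * B)) := by
  rw [single, tensor_conjTranspose, pauliString, tensor_mul, tensor_mul]
  congr 1
  funext j
  by_cases h : j = n
  · subst h; simp
  · simp [h]

/-! ### Rotations -/

theorem exp_smul_conj_diagonal (z : ℂ) (U V : Matrix (Fin 2) (Fin 2) ℂ) (hUV : U * V = 1) :
    NormedSpace.exp (z • (U * Matrix.diagonal ![1, -1] * V)) =
      U * Matrix.diagonal ![Complex.exp z, Complex.exp (-z)] * V := by
  have hV : V = U⁻¹ := (Matrix.inv_eq_right_inv hUV).symm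
  have hU : IsUnit U := (Matrix.isUnit_iff_isUnit_det _).2 (Matrix.isUnit_det_of_right_inverse hUV)
  subst hV
  have h : z • (U * Matrix.diagonal ![1, -1] * U⁻¹) = U * Matrix.diagonal ![z, -z] * U⁻¹ := by
    rw [← Matrix.smul_mul, ← Matrix.mul_smul, ← Matrix.diagonal_smul]
    congr 3
    ext j; fin_cases j <;> simp
  rw [h, Matrix.exp_conj _ _ hU, Matrix.exp_diagonal]
  congr 3
  ext j
  rw [Pi.coe_exp, ← Complex.exp_eq_exp_ℂ]
  fin_cases j <;> simp

theorem pauliRotation_axis (g : Bool) (t : ℝ) :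
    pauliRotation (pauli (axis g)) t =
      if g then !![(Real.cos (t / 2) : ℂ), -(Real.sin (t / 2) : ℂ);
        (Real.sin (t / 2) : ℂ), (Real.cos (t / 2) : ℂ)]
      else !![(Real.cos (t / 2) : ℂ), -(Complex.I * (Real.sin (t / 2) : ℂ));
        -(Complex.I * (Real.sin (t / 2) : ℂ)), (Real.cos (t / 2) : ℂ)] := by
  have h1 : Complex.exp (-(Complex.I * ((t / 2 : ℝ) : ℂ))) =
      Real.cos (t / 2) - Complex.I * Real.sin (t / 2) := by
    rw [show -(Complex.I * ((t / 2 : ℝ) : ℂ)) = ((-(t / 2) : ℝ) : ℂ) * Complex.I by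
      push_cast; ring, Complex.exp_mul_I, ← Complex.ofReal_cos, ← Complex.ofReal_sin]
    simp only [Real.cos_neg, Real.sin_neg]; push_cast; ring
  have h2 : Complex.exp (-(-(Complex.I * ((t / 2 : ℝ) : ℂ)))) =
      Real.cos (t / 2) + Complex.I * Real.sin (t / 2) := by
    rw [show -(-(Complex.I * ((t / 2 : ℝ) : ℂ))) = ((t / 2 : ℝ) : ℂ) * Complex.I by
      ring, Complex.exp_mul_I, ← Complex.ofReal_cos, ← Complex.ofReal_sin]
    ring
  cases g
  -- The columns of the left factor are eigenvectors for the eigenvalues 1 and -1.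
  · have hG : pauli (axis false) =
        !![1, 1; 1, -1] * Matrix.diagonal ![1, -1] * !![1 / 2, 1 / 2; 1 / 2, -1 / 2] := by
      ext a b
      fin_cases a <;> fin_cases b <;> norm_num [pauli, axis, Matrix.mul_apply, Fin.sum_univ_two, Matrix.vecMul_diagonal]
    rw [pauliRotation, hG, exp_smul_conj_diagonal _ _ _ (by
      ext a b; fin_cases a <;> fin_cases b <;> norm_num [Matrix.mul_apply, Fin.sum_univ_two, Matrix.vecMul_diagonal]),
      h1, h2]
    ext a b
    fin_cases a <;> fin_cases b <;>
      simp [Matrix.mul_apply, Fin.sum_univ_two, Matrix.vecMul_diagonal] <;> ring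
  · have hG : pauli (axis true) = !![1, 1; Complex.I, -Complex.I] * Matrix.diagonal ![1, -1] *
        !![1 / 2, -Complex.I / 2; 1 / 2, Complex.I / 2] := by
      ext a b
      fin_cases a <;> fin_cases b <;> simp [pauli, axis, Matrix.mul_apply, Fin.sum_univ_two,
        Matrix.vecMul_diagonal] <;> ring_nf
    rw [pauliRotation, hG, exp_smul_conj_diagonal _ _ _ (by
      ext a b
      fin_cases a <;> fin_cases b <;> simp [Matrix.mul_apply, Fin.sum_univ_two] <;>
        (ring_nf <;> simp)), h1, h2]
    ext a b
    fin_cases a <;> fin_cases b <;>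
      simp [Matrix.mul_apply, Fin.sum_univ_two, Matrix.vecMul_diagonal] <;>
      ring_nf <;> simp

/-- A Pauli matrix commuting with the generator passes through. An anticommuting one is turned by
the full angle `t`, because the half angles of the two sides add up. -/
theorem pauliRotation_conj (g : Bool) (t : ℝ) (p : Fin 4) :
    (pauliRotation (pauli (axis g)) t)ᴴ * pauli p * pauliRotation (pauli (axis g)) t =
      if Fixed g p then pauli p
      else ((Real.cos t : ℝ) : ℂ) • pauli p +
        ((rotSign g p * Real.sin t : ℝ) : ℂ) • pauli (partner g p) := by
  have h : (Real.sin (t / 2) : ℂ) ^ 2 = 1 - (Real.cos (t / 2) : ℂ) ^ 2 := by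
    exact_mod_cast Real.sin_sq _
  have hc : Real.cos t = 2 * Real.cos (t / 2) ^ 2 - 1 := by
    rw [← Real.cos_two_mul]; congr 1; ring
  have hs : Real.sin t = 2 * Real.sin (t / 2) * Real.cos (t / 2) := by
    rw [← Real.sin_two_mul]; congr 1; ring
  rw [pauliRotation_axis, hc, hs]
  generalize Real.cos (t / 2) = c at *
  generalize Real.sin (t / 2) = s at *
  cases g <;> fin_cases p <;> ext a b <;> fin_cases a <;> fin_cases b <;>
    simp [Matrix.mul_apply, Fin.sum_univ_two, pauli, partner, rotSign, Fixed, axis] <;>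
    ring_nf <;> simp [h, Complex.I_sq] <;> ring

/-! ### Controlled-`Z` gates -/

/-- The two-qubit core of `czGate_conj`, entry by entry: an X or Y on one qubit multiplies the other
factor by Z, and only the pairs XY and YX pick up a sign. -/
theorem pauli_cz (p r : Fin 4) (x y z w : Fin 2) :
    (if x = 1 ∧ z = 1 then (-1 : ℂ) else 1) * (pauli p x y * pauli r z w) *
        (if y = 1 ∧ w = 1 then (-1 : ℂ) else 1) =
      (if p = 1 ∧ r = 2 ∨ p = 2 ∧ r = 1 then (-1 : ℂ) else 1) *
        (pauli (if IsXY r then zMul p else p) x y *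
          pauli (if IsXY p then zMul r else r) z w) := by
  fin_cases p <;> fin_cases r <;> fin_cases x <;> fin_cases y <;> fin_cases z <;> fin_cases w <;>
    simp [pauli, IsXY, zMul]

theorem czGate_conj (p : QubitPair N) (i : Fin N → Fin 4) :
    (czGate p)ᴴ * pauliString i * czGate p = (czSign p i : ℂ) • pauliString (czMap p i) := by
  obtain ⟨⟨a, b⟩, hab⟩ := p
  replace hab : a ≠ b := hab
  ext x y
  have hsplit : ∀ k : Fin N → Fin 4, pauliString k x y =
      pauli (k a) (x a) (y a) * pauli (k b) (x b) (y b) *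
        ∏ j ∈ (Finset.univ \ {a}) \ {b}, pauli (k j) (x j) (y j) := by
    intro k
    simp only [pauliString, tensor, Matrix.of_apply]
    rw [← Finset.mul_prod_erase _ _ (Finset.mem_univ a), mul_assoc,
      ← Finset.mul_prod_erase _ _ (show b ∈ Finset.univ.erase a by simp [hab.symm])]
    congr 2
    simp [Finset.sdiff_singleton_eq_erase]
  have hrest : ∏ j ∈ (Finset.univ \ {a}) \ {b}, pauli (czMap ⟨(a, b), hab⟩ i j) (x j) (y j) =
      ∏ j ∈ (Finset.univ \ {a}) \ {b}, pauli (i j) (x j) (y j) := by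
    refine Finset.prod_congr rfl fun j hj => ?_
    simp only [Finset.mem_sdiff, Finset.mem_univ, Finset.mem_singleton, true_and] at hj
    simp [czMap, hj.1, hj.2]
  have ha : czMap ⟨(a, b), hab⟩ i a = if IsXY (i b) then zMul (i a) else i a := by
    simp [czMap, hab]
  have hb : czMap ⟨(a, b), hab⟩ i b = if IsXY (i a) then zMul (i b) else i b := by
    simp [czMap, hab.symm]
  have hd : (czGate ⟨(a, b), hab⟩)ᴴ = czGate ⟨(a, b), hab⟩ := by
    rw [czGate, Matrix.diagonal_conjTranspose]
    congr 1
    funext x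
    simp only [Pi.star_apply]
    split_ifs <;> simp
  rw [hd, czGate, Matrix.mul_diagonal, Matrix.diagonal_mul, Matrix.smul_apply, hsplit, hsplit,
    hrest, ha, hb]
  have h := pauli_cz (i a) (i b) (x a) (y a) (x b) (y b)
  have hs : ((czSign ⟨(a, b), hab⟩ i : ℝ) : ℂ) =
      if i a = 1 ∧ i b = 2 ∨ i a = 2 ∧ i b = 1 then (-1 : ℂ) else 1 := by
    simp only [czSign]; split_ifs <;> simp
  rw [smul_eq_mul, hs, ← mul_assoc, ← mul_assoc _ _ (∏ j ∈ _, _), ← h]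
  simp only
  ring

end ReducedDomainVQE

/-! ### Expectations of Pauli strings in the Heisenberg picture -/

namespace ReducedDomainVQE

variable {N : ℕ} {Q : Type*}

/-- A one-parameter rotation of the qubit `k.2` with parameter `k`, or a controlled-`Z` gate. -/
inductive Gate (N : ℕ) (Q : Type*) : Type _
  | rot (g : Bool) (k : Q × Fin N) : Gate N Q
  | cz (p : QubitPair N) : Gate N Q

namespace Gate

/-- The operator of a gate. -/
noncomputable def op (θ : Q × Fin N → ℝ) : Gate N Q → Operator N
  | rot g k => single k.2 (pauliRotation (pauli (axis g)) (θ k))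
  | cz p => czGate p

/-- The parameters of a sequence of gates, with multiplicity. -/
def params : List (Gate N Q) → List (Q × Fin N)
  | [] => []
  | rot _ k :: gs => k :: params gs
  | cz _ :: gs => params gs

/-- The expectation of a Pauli string in the state `|0⋯0⟩`. -/
noncomputable def baseValue (i : Fin N → Fin 4) : ℝ := if ∀ n, i n = 0 ∨ i n = 3 then 1 else 0

/-- The expectation of a Pauli string after a sequence of gates, computed in the Heisenberg
picture. The weights `w k = (u, c, s)` belong to the invariant part, the cosine and the sine of the
rotation with parameter `k`. -/
noncomputable def expect (w : Q × Fin N → ℝ × ℝ × ℝ) : List (Gate N Q) → (Fin N → Fin 4) → ℝ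
  | [], i => baseValue i
  | rot g k :: gs, i =>
    if Fixed g (i k.2) then (w k).1 * expect w gs i
    else (w k).2.1 * expect w gs i + rotSign g (i k.2) * (w k).2.2 *
      expect w gs (Function.update i k.2 (partner g (i k.2)))
  | cz p :: gs, i => czSign p i * expect w gs (czMap p i)

/-- The weights of a rotation by the angle `t`. -/
noncomputable def trig (t : ℝ) : ℝ × ℝ × ℝ := (1, Real.cos t, Real.sin t)

/-- The derivative of `trig`. -/
noncomputable def trigDeriv (t : ℝ) : ℝ × ℝ × ℝ := (0, -Real.sin t, Real.cos t)

theorem trace_pauliString_mul_single (i : Fin N → Fin 4) :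
    (pauliString i * Matrix.single 0 0 1).trace = (baseValue i : ℂ) := by
  rw [Matrix.trace_mul_comm, Matrix.trace_single_mul]
  simp only [pauliString, tensor, Matrix.of_apply, Pi.zero_apply, baseValue]
  split_ifs with h
  · rw [Finset.prod_eq_one]
    · simp
    · intro j _
      rcases h j with h | h <;> simp [h, pauli]
  · push Not at h
    obtain ⟨j, h0, h3⟩ := h
    rw [Finset.prod_eq_zero (Finset.mem_univ j)]
    · simp
    · generalize i j = p at *
      fin_cases p <;> simp_all [pauli]

/-- The head of the list is the leftmost factor, i.e. the gate applied last to the state. By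
cyclicity of the trace it is the first to conjugate the observable. -/
theorem trace_eq_expect (θ : Q × Fin N → ℝ) (gs : List (Gate N Q)) (i : Fin N → Fin 4) :
    (pauliString i * (gs.map (op θ)).prod * Matrix.single 0 0 1 *
      ((gs.map (op θ)).prod)ᴴ).trace = (expect (fun k => trig (θ k)) gs i : ℂ) := by
  induction gs generalizing i with
  | nil => simpa [expect] using trace_pauliString_mul_single i
  | cons G gs ih =>
    set W := (gs.map (op θ)).prod with hW
    have hstep : (pauliString i * ((G :: gs).map (op θ)).prod * Matrix.single 0 0 1 *
        (((G :: gs).map (op θ)).prod)ᴴ).trace =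
        ((op θ G)ᴴ * pauliString i * op θ G * (W * Matrix.single 0 0 1 * Wᴴ)).trace := by
      rw [List.map_cons, List.prod_cons, Matrix.conjTranspose_mul, ← hW, ← mul_assoc,
        Matrix.trace_mul_comm]
      simp only [mul_assoc]
    rw [hstep]
    have ih' : ∀ j, (pauliString j * (W * Matrix.single 0 0 1 * Wᴴ)).trace =
        (expect (fun k => trig (θ k)) gs j : ℂ) := by
      intro j
      rw [← ih j]
      simp only [mul_assoc]
    cases G with
    | cz p =>
      rw [op, czGate_conj, Matrix.smul_mul, Matrix.trace_smul, ih', expect]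
      simp
    | rot g k =>
      rw [op, single_conj, pauliRotation_conj, expect]
      split_ifs with h
      · rw [← pauliString_update, Function.update_eq_self, ih']
        simp [trig]
      · rw [tensor_update_add, ← pauliString_update, ← pauliString_update,
          Function.update_eq_self, Matrix.add_mul, Matrix.smul_mul, Matrix.smul_mul,
          Matrix.trace_add, Matrix.trace_smul, Matrix.trace_smul, ih', ih']
        simp [trig]

theorem expect_congr {w w' : Q × Fin N → ℝ × ℝ × ℝ} (gs : List (Gate N Q))
    (h : ∀ k ∈ params gs, w k = w' k) (i : Fin N → Fin 4) : expect w gs i = expect w' gs i := by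
  induction gs generalizing i with
  | nil => rfl
  | cons G gs ih =>
    cases G with
    | cz p => rw [expect, expect, ih h]
    | rot g k =>
      have hk := h k (by simp [params])
      have ih' := ih fun k' hk' => h k' (by simp [params, hk'])
      rw [expect, expect, hk, ih', ih']

/-- Since `v` occurs only once, the expectation is linear in the weight triple of `v`, so it
suffices to differentiate that triple. -/
theorem hasDerivAt_expect [DecidableEq Q] (gs : List (Gate N Q)) (hgs : (params gs).Nodup)
    (v : Q × Fin N) (hv : v ∈ params gs) (θ : Q × Fin N → ℝ) (i : Fin N → Fin 4) :
    HasDerivAt (fun t => expect (fun k => trig (Function.update θ v t k)) gs i)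
      (expect (fun k => (if k = v then trigDeriv else trig) (θ k)) gs i) (θ v) := by
  induction gs generalizing i with
  | nil => simp [params] at hv
  | cons G gs ih =>
    cases G with
    | cz p => exact (ih hgs hv _).const_mul _
    | rot g k =>
      rw [params, List.nodup_cons] at hgs
      by_cases hk : k = v
      · subst hk
        -- By `Nodup` the remaining gates do not contain the parameter, so their part is constant in
        -- `t`.
        have hconst : ∀ (t : ℝ) (j : Fin N → Fin 4),
            expect (fun k' => trig (Function.update θ k t k')) gs j =
              expect (fun k' => (if k' = k then trigDeriv else trig) (θ k')) gs j := by
          intro t j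
          refine expect_congr _ (fun k' hk' => ?_) _
          have : k' ≠ k := by rintro rfl; exact hgs.1 hk'
          simp [this]
        simp only [expect, hconst, Function.update_self, if_true]
        split_ifs with h
        · simpa [trig, trigDeriv] using hasDerivAt_const (θ k) _
        · exact ((Real.hasDerivAt_cos (θ k)).mul_const _).add
            (((Real.hasDerivAt_sin (θ k)).const_mul _).mul_const _)
      · have hv' : v ∈ params gs := by
          rw [params, List.mem_cons] at hv
          exact hv.resolve_left (Ne.symm hk)
        have ih' := ih hgs.2 hv'
        simp only [expect, Function.update_of_ne hk, if_neg hk]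
        split_ifs with h
        · exact (ih' i).const_mul _
        · exact ((ih' i).const_mul _).add ((ih' _).const_mul _)

theorem continuous_expect {A : Q × Fin N → ℝ → ℝ × ℝ × ℝ} (hA : ∀ k, Continuous (A k))
    (gs : List (Gate N Q)) (i : Fin N → Fin 4) :
    Continuous fun θ : Q × Fin N → ℝ => expect (fun k => A k (θ k)) gs i := by
  induction gs generalizing i with
  | nil => exact continuous_const
  | cons G gs ih =>
    cases G with
    | cz p => exact (ih _).const_mul _
    | rot g k =>
      have h : Continuous fun θ : Q × Fin N → ℝ => A k (θ k) := (hA k).comp (continuous_apply k)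
      simp only [expect]
      split_ifs
      · exact h.fst.mul (ih i)
      · exact (h.snd.fst.mul (ih i)).add ((h.snd.snd.const_mul _).mul (ih _))

/-! ### Reflections of the angles on one qubit -/

/-- The reflection of all angles on the qubit `m`. -/
def reflect (m : Fin N) (θ : Q × Fin N → ℝ) (k : Q × Fin N) : ℝ := if k.2 = m then -θ k else θ k

/-- The parity of a Pauli matrix under conjugation with `Z`. -/
noncomputable def parity (p : Fin 4) : ℝ := if IsXY p then -1 else 1

theorem parity_partner {g : Bool} {p : Fin 4} (h : ¬Fixed g p) :
    parity (partner g p) = -parity p := by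
  revert h
  cases g <;> fin_cases p <;> simp [Fixed, axis, partner, parity, IsXY]

theorem parity_zMul (p : Fin 4) : parity (zMul p) = parity p := by
  fin_cases p <;> simp [parity, IsXY, zMul]

/-- Each sine branch on qubit `m` changes sign and also flips the parity of the factor there; cosine
branches and `CZ` gates do neither. At the end only I and Z survive, which are even, so the total
sign is the initial parity. -/
theorem expect_reflect (m : Fin N) (θ : Q × Fin N → ℝ) (gs : List (Gate N Q))
    (i : Fin N → Fin 4) :
    expect (fun k => trig (reflect m θ k)) gs i =
      parity (i m) * expect (fun k => trig (θ k)) gs i := by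
  induction gs generalizing i with
  | nil =>
    simp only [expect, baseValue]
    split_ifs with h
    · rcases h m with h | h <;> simp [parity, IsXY, h]
    · simp
  | cons G gs ih =>
    cases G with
    | cz p =>
      have h : parity (czMap p i m) = parity (i m) := by
        unfold czMap; split_ifs <;> simp [parity_zMul]
      rw [expect, expect, ih, h]; ring
    | rot g k =>
      simp only [expect, ih]
      split_ifs with h
      · simp [trig]
      · by_cases hm : k.2 = m
        · subst hm
          simp only [Function.update_self, parity_partner h, trig, reflect, if_true,
            Real.cos_neg, Real.sin_neg]
          ring
        · simp only [Function.update_of_ne (Ne.symm hm), trig, reflect, if_neg hm]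
          ring

end Gate

end ReducedDomainVQE

namespace ReducedDomainVQE

/-! ### Second moments -/

/-- A continuous function of finitely many independent bounded variables has all moments. -/
theorem memLp_pi_of_continuous {κ : Type*} [Fintype κ] {μ : Measure ℝ} [IsProbabilityMeasure μ]
    {K : Set ℝ} (hK : IsCompact K) (hμ : ∀ᵐ x ∂μ, x ∈ K) {F : (κ → ℝ) → ℝ} (hF : Continuous F)
    (p : ENNReal) : MemLp F p (Measure.pi fun _ : κ => μ) := by
  obtain ⟨C, hC⟩ := (isCompact_univ_pi fun _ : κ => hK).exists_bound_of_continuousOn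
    hF.continuousOn
  refine MemLp.of_bound hF.aestronglyMeasurable C ?_
  have h : ∀ᵐ θ ∂(Measure.pi fun _ : κ => μ), ∀ k, θ k ∈ K :=
    eventually_all.2 fun k => Measure.tendsto_eval_ae_ae.eventually hμ
  filter_upwards [h] with θ hθ
  exact hC θ fun k _ => hθ k

namespace Gate

variable {N : ℕ} {Q : Type*}

/-- The expectation of the product of two Heisenberg-evolved Pauli strings, in terms of the moments
`uu`, `uc`, `cc`, `ss` of the weights `u`, `c`, `s` of the rotations. -/
noncomputable def pairMoment (uu uc cc ss : Q × Fin N → ℝ) :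
    List (Gate N Q) → (Fin N → Fin 4) → (Fin N → Fin 4) → ℝ
  | [], i, j => baseValue i * baseValue j
  | rot g k :: gs, i, j =>
    if Fixed g (i k.2) then
      if Fixed g (j k.2) then uu k * pairMoment uu uc cc ss gs i j
      else uc k * pairMoment uu uc cc ss gs i j
    else
      if Fixed g (j k.2) then uc k * pairMoment uu uc cc ss gs i j
      else cc k * pairMoment uu uc cc ss gs i j +
        rotSign g (i k.2) * rotSign g (j k.2) * ss k *
          pairMoment uu uc cc ss gs (Function.update i k.2 (partner g (i k.2)))
            (Function.update j k.2 (partner g (j k.2)))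
  | cz p :: gs, i, j =>
    czSign p i * czSign p j * pairMoment uu uc cc ss gs (czMap p i) (czMap p j)

/-- The factors `h k` strengthen the induction: the weights of the head gate are absorbed into `h`
at its own parameter, where `h` is still 1 and which the remaining gates do not involve. -/
theorem integral_prod_mul_expect_mul_expect [Fintype Q] [DecidableEq Q] {μ : Measure ℝ}
    [IsProbabilityMeasure μ] {K : Set ℝ} (hK : IsCompact K) (hμ : ∀ᵐ x ∂μ, x ∈ K)
    {A : Q × Fin N → ℝ → ℝ × ℝ × ℝ} (hA : ∀ k, Continuous (A k)) {uu uc cc ss : Q × Fin N → ℝ}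
    (huu : ∀ k, ∫ t, (A k t).1 * (A k t).1 ∂μ = uu k)
    (huc : ∀ k, ∫ t, (A k t).1 * (A k t).2.1 ∂μ = uc k)
    (hcc : ∀ k, ∫ t, (A k t).2.1 * (A k t).2.1 ∂μ = cc k)
    (hss : ∀ k, ∫ t, (A k t).2.2 * (A k t).2.2 ∂μ = ss k)
    (hus : ∀ k, ∫ t, (A k t).1 * (A k t).2.2 ∂μ = 0)
    (hcs : ∀ k, ∫ t, (A k t).2.1 * (A k t).2.2 ∂μ = 0)
    (gs : List (Gate N Q)) (hgs : (params gs).Nodup) (h : Q × Fin N → ℝ → ℝ)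
    (hh : ∀ k, Continuous (h k)) (h1 : ∀ k ∈ params gs, h k = fun _ => 1)
    (i j : Fin N → Fin 4) :
    ∫ θ, (∏ k, h k (θ k)) * (expect (fun k => A k (θ k)) gs i * expect (fun k => A k (θ k)) gs j)
        ∂(Measure.pi fun _ : Q × Fin N => μ) =
      (∏ k, ∫ t, h k t ∂μ) * pairMoment uu uc cc ss gs i j := by
  induction gs generalizing i j h with
  | nil =>
    simp only [expect, pairMoment]
    rw [integral_mul_const, integral_fintype_prod_eq_prod]
  | cons G gs ih =>
    cases G with
    | cz p =>
      simp only [expect, pairMoment]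
      rw [mul_left_comm, ← ih hgs h hh h1 (czMap p i) (czMap p j), ← integral_const_mul]
      refine integral_congr_ae (Eventually.of_forall fun θ => ?_)
      simp only
      ring
    | rot g k =>
      rw [params, List.nodup_cons] at hgs
      have hk1 : h k = fun _ => 1 := h1 k (by simp [params])
      -- Splitting off one function `φ` of the head angle; each case below applies this to products
      -- of two weights.
      have step : ∀ (φ : ℝ → ℝ), Continuous φ → ∀ i' j' : Fin N → Fin 4,
          Integrable (fun θ : Q × Fin N → ℝ => (∏ k, h k (θ k)) * (φ (θ k) *
            (expect (fun k => A k (θ k)) gs i' * expect (fun k => A k (θ k)) gs j')))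
              (Measure.pi fun _ : Q × Fin N => μ) ∧
          ∫ θ, (∏ k, h k (θ k)) * (φ (θ k) *
            (expect (fun k => A k (θ k)) gs i' * expect (fun k => A k (θ k)) gs j'))
              ∂(Measure.pi fun _ : Q × Fin N => μ) =
          (∏ k, ∫ t, h k t ∂μ) * ((∫ t, φ t ∂μ) * pairMoment uu uc cc ss gs i' j') := by
        intro φ hφ i' j'
        constructor
        · refine (memLp_pi_of_continuous hK hμ ?_ 1).integrable le_rfl
          exact (continuous_finsetProd _ fun k' _ => (hh k').comp (continuous_apply k')).mul
            ((hφ.comp (continuous_apply k)).mul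
              ((continuous_expect hA gs i').mul (continuous_expect hA gs j')))
        · have key := ih hgs.2 (Function.update h k φ)
            (fun k' => by
              by_cases hk : k' = k
              · subst hk; simpa using hφ
              · simpa [hk] using hh k')
            (fun k' hk' => by
              have : k' ≠ k := by rintro rfl; exact hgs.1 hk'
              simpa [this] using h1 k' (by simp [params, hk'])) i' j'
          have hprod : ∀ θ : Q × Fin N → ℝ, ∏ k', Function.update h k φ k' (θ k') =
              (∏ k', h k' (θ k')) * φ (θ k) := by
            intro θ
            rw [← Finset.mul_prod_erase _ _ (Finset.mem_univ k),
              ← Finset.mul_prod_erase _ (fun k' => h k' (θ k')) (Finset.mem_univ k), hk1]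
            simp only [Function.update_self, one_mul]
            rw [mul_comm]
            congr 1
            refine Finset.prod_congr rfl fun k' hk' => ?_
            rw [Function.update_of_ne (Finset.ne_of_mem_erase hk')]
          have hint : ∏ k', ∫ t, Function.update h k φ k' t ∂μ =
              (∏ k', ∫ t, h k' t ∂μ) * ∫ t, φ t ∂μ := by
            rw [← Finset.mul_prod_erase _ _ (Finset.mem_univ k),
              ← Finset.mul_prod_erase _ (fun k' => ∫ t, h k' t ∂μ) (Finset.mem_univ k), hk1]
            simp only [Function.update_self, integral_const, probReal_univ, smul_eq_mul, one_mul]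
            rw [mul_comm]
            congr 1
            refine Finset.prod_congr rfl fun k' hk' => ?_
            rw [Function.update_of_ne (Finset.ne_of_mem_erase hk')]
          rw [hint] at key
          rw [← mul_assoc, ← key]
          refine integral_congr_ae (Eventually.of_forall fun θ => ?_)
          simp only [hprod]
          ring
      have cu : Continuous fun t => (A k t).1 := (hA k).fst
      have cc' : Continuous fun t => (A k t).2.1 := (hA k).snd.fst
      have cs : Continuous fun t => (A k t).2.2 := (hA k).snd.snd
      simp only [expect, pairMoment]
      set i' := Function.update i k.2 (partner g (i k.2))
      set j' := Function.update j k.2 (partner g (j k.2))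
      by_cases hi : Fixed g (i k.2) <;> by_cases hj : Fixed g (j k.2)
      · simp only [hi, hj, if_true]
        rw [← huu, ← (step (fun t => (A k t).1 * (A k t).1) (cu.mul cu) i j).2]
        refine integral_congr_ae (Eventually.of_forall fun θ => ?_)
        simp only
        ring
      · simp only [hi, hj, if_true, if_false]
        have e1 := step (fun t => (A k t).1 * (A k t).2.1) (cu.mul cc')
          i j
        have e2 := step (fun t => rotSign g (j k.2) * ((A k t).1 * (A k t).2.2))
          ((cu.mul cs).const_mul _)
          i j'
        rw [integral_const_mul, hus, mul_zero, zero_mul, mul_zero] at e2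
        have e := integral_add e1.1 e2.1
        rw [e1.2, e2.2, add_zero] at e
        rw [← huc, ← e]
        refine integral_congr_ae (Eventually.of_forall fun θ => ?_)
        simp only
        ring
      · simp only [hi, hj, if_true, if_false]
        have e1 := step (fun t => (A k t).1 * (A k t).2.1) (cu.mul cc')
          i j
        have e2 := step (fun t => rotSign g (i k.2) * ((A k t).1 * (A k t).2.2))
          ((cu.mul cs).const_mul _)
          i' j
        rw [integral_const_mul, hus, mul_zero, zero_mul, mul_zero] at e2
        have e := integral_add e1.1 e2.1
        rw [e1.2, e2.2, add_zero] at e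
        rw [← huc, ← e]
        refine integral_congr_ae (Eventually.of_forall fun θ => ?_)
        simp only
        ring
      · simp only [hi, hj, if_false]
        have e1 := step (fun t => (A k t).2.1 * (A k t).2.1) (cc'.mul cc')
          i j
        have e2 := step (fun t => rotSign g (j k.2) * ((A k t).2.1 * (A k t).2.2))
          ((cc'.mul cs).const_mul _)
          i j'
        have e3 := step (fun t => rotSign g (i k.2) * ((A k t).2.1 * (A k t).2.2))
          ((cc'.mul cs).const_mul _)
          i' j
        have e4 := step (fun t => rotSign g (i k.2) * rotSign g (j k.2) * ((A k t).2.2 * (A k t).2.2))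
          ((cs.mul cs).const_mul _)
          i' j'
        -- The two mixed cos-sin branches integrate to zero, leaving cos² and sin².
        rw [integral_const_mul, hcs, mul_zero, zero_mul, mul_zero] at e2 e3
        rw [integral_const_mul, hss] at e4
        have e := integral_add' ((e1.1.add e4.1).add e2.1) e3.1
        rw [integral_add' (e1.1.add e4.1) e2.1, integral_add' e1.1 e4.1, e1.2, e2.2, e3.2, e4.2,
          add_zero, add_zero, ← mul_add] at e
        rw [← hcc, ← e]
        refine integral_congr_ae (Eventually.of_forall fun θ => ?_)
        simp only [Pi.add_apply]
        ring

end Gate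

end ReducedDomainVQE

namespace ReducedDomainVQE

namespace Gate

variable {N : ℕ} {Q : Type*}

/-! ### Positivity of second moments -/

/-- Two Pauli matrices that are equal or differ by `Z`, acting trivially on `|0⟩`. -/
def Compatible (p q : Fin 4) : Prop := p = q ∨ p = 0 ∧ q = 3 ∨ p = 3 ∧ q = 0

instance (p q : Fin 4) : Decidable (Compatible p q) := by unfold Compatible; infer_instance

theorem compatible_partner {g : Bool} {p q : Fin 4} (hp : ¬Fixed g p) (hq : ¬Fixed g q) :
    Compatible (partner g p) (partner g q) ↔ p = q := by
  revert g p q; decide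

theorem compatible_iff_eq {g : Bool} {p q : Fin 4} (hp : ¬Fixed g p) (hq : ¬Fixed g q) :
    Compatible p q ↔ p = q := by
  revert g p q; decide

/-- If two compatible factors differ, both are in {I, Z}, so neither affects the other qubit;
multiplying both by Z preserves compatibility. The converse holds since the map is an involution. -/
theorem compatible_cz (p q r s : Fin 4) :
    Compatible (if IsXY q then zMul p else p) (if IsXY s then zMul r else r) ∧
      Compatible (if IsXY p then zMul q else q) (if IsXY r then zMul s else s) ↔
    Compatible p r ∧ Compatible q s := by
  revert p q r s; decide

/-- Compatible factors that differ are I and Z, and these never produce a sign. -/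
theorem compatible_czSign {p q r s : Fin 4} (hp : Compatible p r) (hq : Compatible q s) :
    (p = 1 ∧ q = 2 ∨ p = 2 ∧ q = 1) ↔ (r = 1 ∧ s = 2 ∨ r = 2 ∧ s = 1) := by
  revert p q r s; decide

theorem compatible_czMap (p : QubitPair N) (i j : Fin N → Fin 4) :
    (∀ n, Compatible (czMap p i n) (czMap p j n)) ↔ ∀ n, Compatible (i n) (j n) := by
  obtain ⟨⟨a, b⟩, hab⟩ := p
  replace hab : a ≠ b := hab
  have ha : ∀ i, czMap ⟨(a, b), hab⟩ i a = if IsXY (i b) then zMul (i a) else i a := by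
    intro i; simp [czMap, hab]
  have hb : ∀ i, czMap ⟨(a, b), hab⟩ i b = if IsXY (i a) then zMul (i b) else i b := by
    intro i; simp [czMap, hab.symm]
  have hn : ∀ i, ∀ n, n ≠ a → n ≠ b → czMap ⟨(a, b), hab⟩ i n = i n := by
    intro i n h1 h2; simp [czMap, h1, h2]
  have key := compatible_cz (i a) (i b) (j a) (j b)
  rw [← ha, ← hb, ← ha, ← hb] at key
  constructor <;> intro h n
  · by_cases h1 : n = a
    · subst h1; exact (key.1 ⟨h _, h _⟩).1
    by_cases h2 : n = b
    · subst h2; exact (key.1 ⟨h _, h _⟩).2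
    · simpa [hn _ n h1 h2] using h n
  · by_cases h1 : n = a
    · subst h1; exact (key.2 ⟨h _, h _⟩).1
    by_cases h2 : n = b
    · subst h2; exact (key.2 ⟨h _, h _⟩).2
    · simpa [hn _ n h1 h2] using h n

theorem czSign_mul_self (p : QubitPair N) (i : Fin N → Fin 4) : czSign p i * czSign p i = 1 := by
  unfold czSign; split_ifs <;> norm_num

theorem rotSign_mul_self {g : Bool} {p : Fin 4} (hp : ¬Fixed g p) :
    rotSign g p * rotSign g p = 1 := by
  revert hp
  cases g <;> fin_cases p <;> simp [Fixed, axis, rotSign]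

variable {uu uc cc ss : Q × Fin N → ℝ}

/-- Incompatibility is inherited by every branch of the recursion, while the base value requires
both strings to consist of I and Z only, which are compatible. -/
theorem pairMoment_eq_zero (gs : List (Gate N Q)) {i j : Fin N → Fin 4}
    (hij : ¬∀ n, Compatible (i n) (j n)) : pairMoment uu uc cc ss gs i j = 0 := by
  induction gs generalizing i j with
  | nil =>
    simp only [pairMoment, baseValue]
    split_ifs with hi hj
    · refine absurd (fun n => ?_) hij
      rcases hi n with h | h <;> rcases hj n with h' | h' <;> simp [h, h', Compatible]
    all_goals simp
  | cons G gs ih =>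
    cases G with
    | cz p => rw [pairMoment, ih (by rwa [compatible_czMap]), mul_zero]
    | rot g k =>
      simp only [pairMoment, ih hij, mul_zero]
      split_ifs with hi hj <;> try rfl
      -- In the sine branch, compatible partners would force equal original factors.
      rw [ih, mul_zero, add_zero]
      rename_i hj
      intro h
      refine hij fun n => ?_
      by_cases hn : n = k.2
      · subst hn
        have := h k.2
        simp only [Function.update_self] at this
        exact Or.inl ((compatible_partner hi hj).1 this)
      · simpa [hn] using h n

/-- Only compatible pairs contribute, and for them the signs of the two strings coincide at each
gate and multiply to 1. -/
theorem pairMoment_nonneg (huu : ∀ k, 0 ≤ uu k) (huc : ∀ k, 0 ≤ uc k) (hcc : ∀ k, 0 ≤ cc k)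
    (hss : ∀ k, 0 ≤ ss k) (gs : List (Gate N Q)) (i j : Fin N → Fin 4) :
    0 ≤ pairMoment uu uc cc ss gs i j := by
  induction gs generalizing i j with
  | nil =>
    simp only [pairMoment, baseValue]
    split_ifs <;> norm_num
  | cons G gs ih =>
    by_cases hij : ∀ n, Compatible (i n) (j n)
    · cases G with
      | cz p =>
        have : czSign p j = czSign p i := by
          unfold czSign
          simp only [compatible_czSign (hij p.1.1) (hij p.1.2)]
        rw [pairMoment, this, czSign_mul_self, one_mul]
        exact ih _ _
      | rot g k =>
        simp only [pairMoment]
        split_ifs with hi hj hj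
        · exact mul_nonneg (huu k) (ih _ _)
        · exact mul_nonneg (huc k) (ih _ _)
        · exact mul_nonneg (huc k) (ih _ _)
        · rw [← (compatible_iff_eq hi hj).1 (hij k.2), rotSign_mul_self hi, one_mul]
          exact add_nonneg (mul_nonneg (hcc k) (ih _ _)) (mul_nonneg (hss k) (ih _ _))
    · rw [pairMoment_eq_zero _ hij]

/-! ### Lower bounds for the second moment of a Pauli string -/

/-- A rotation about the axis `g` can turn the Pauli matrix `p` into `settle g p`, which is `Z`
unless `p` is invariant. -/
def settle (g : Bool) (p : Fin 4) : Fin 4 := if Fixed g p then p else 3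

/-- The probability of the transition from `p` to `settle g p`. -/
noncomputable def settleWeight (uu cc ss : Q × Fin N → ℝ) (g : Bool) (k : Q × Fin N) (p : Fin 4) : ℝ :=
  if Fixed g p then uu k else if p = 3 then cc k else ss k

theorem settleWeight_nonneg (huu : ∀ k, 0 ≤ uu k) (hcc : ∀ k, 0 ≤ cc k) (hss : ∀ k, 0 ≤ ss k)
    (g : Bool) (k : Q × Fin N) (p : Fin 4) : 0 ≤ settleWeight uu cc ss g k p := by
  unfold settleWeight; split_ifs; exacts [huu k, hcc k, hss k]

theorem partner_eq_three {g : Bool} {p : Fin 4} (hp : ¬Fixed g p) (h3 : p ≠ 3) :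
    partner g p = 3 := by
  revert g p; decide

/-- Of the two nonnegative branches of a mixing rotation, the one ending in Z is kept: cosine if the
factor is already Z, sine otherwise. -/
theorem settleWeight_mul_pairMoment_le (huu : ∀ k, 0 ≤ uu k) (huc : ∀ k, 0 ≤ uc k)
    (hcc : ∀ k, 0 ≤ cc k) (hss : ∀ k, 0 ≤ ss k) (g : Bool) (k : Q × Fin N)
    (gs : List (Gate N Q)) (i : Fin N → Fin 4) :
    settleWeight uu cc ss g k (i k.2) *
        pairMoment uu uc cc ss gs (Function.update i k.2 (settle g (i k.2)))
          (Function.update i k.2 (settle g (i k.2))) ≤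
      pairMoment uu uc cc ss (rot g k :: gs) i i := by
  have hnn := pairMoment_nonneg huu huc hcc hss gs
  simp only [pairMoment, settleWeight, settle]
  by_cases h : Fixed g (i k.2)
  · simp [h]
  · simp only [h, if_false, rotSign_mul_self h, one_mul]
    by_cases h3 : i k.2 = 3
    · rw [if_pos h3, ← h3, Function.update_eq_self]
      exact le_add_of_nonneg_right (mul_nonneg (hss k) (hnn _ _))
    · rw [if_neg h3, partner_eq_three h h3]
      exact le_add_of_nonneg_left (mul_nonneg (hcc k) (hnn _ _))

/-- The rotations of the qubits in `l` about the axis `g`, with parameters in row `q`. -/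
def rotations (g : Bool) (q : Q) (l : List (Fin N)) : List (Gate N Q) := l.map fun n => rot g (q, n)

theorem prod_settleWeight_mul_pairMoment_le_of_nodup (huu : ∀ k, 0 ≤ uu k) (huc : ∀ k, 0 ≤ uc k)
    (hcc : ∀ k, 0 ≤ cc k) (hss : ∀ k, 0 ≤ ss k) (g : Bool) (q : Q) (gs : List (Gate N Q))
    (l : List (Fin N)) (hl : l.Nodup) (i : Fin N → Fin 4) :
    (l.map fun n => settleWeight uu cc ss g (q, n) (i n)).prod *
        pairMoment uu uc cc ss gs (fun n => if n ∈ l then settle g (i n) else i n)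
          (fun n => if n ∈ l then settle g (i n) else i n) ≤
      pairMoment uu uc cc ss (rotations g q l ++ gs) i i := by
  induction l generalizing i with
  | nil => simp [rotations]
  | cons m l ih =>
    rw [List.nodup_cons] at hl
    refine le_trans ?_ (settleWeight_mul_pairMoment_le huu huc hcc hss g (q, m)
      (rotations g q l ++ gs) i)
    rw [List.map_cons, List.prod_cons, mul_assoc]
    refine mul_le_mul_of_nonneg_left (le_trans (le_of_eq ?_) (ih hl.2 _))
      (settleWeight_nonneg huu hcc hss _ _ _)
    have hne : ∀ n ∈ l, n ≠ m := fun n hn h => hl.1 (h ▸ hn)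
    congr 1
    · congr 1
      refine List.map_congr_left fun n hn => ?_
      rw [Function.update_of_ne (hne n hn)]
    · have : (fun n => if n ∈ m :: l then settle g (i n) else i n) = fun n =>
          if n ∈ l then settle g (Function.update i m (settle g (i m)) n)
          else Function.update i m (settle g (i m)) n := by
        funext n
        by_cases hn : n = m
        · subst hn; simp [hl.1]
        · simp [hn]
      rw [this]

theorem prod_settleWeight_mul_pairMoment_le (huu : ∀ k, 0 ≤ uu k) (huc : ∀ k, 0 ≤ uc k)
    (hcc : ∀ k, 0 ≤ cc k) (hss : ∀ k, 0 ≤ ss k) (g : Bool) (q : Q) (gs : List (Gate N Q))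
    (i : Fin N → Fin 4) :
    (∏ n, settleWeight uu cc ss g (q, n) (i n)) *
        pairMoment uu uc cc ss gs (fun n => settle g (i n)) (fun n => settle g (i n)) ≤
      pairMoment uu uc cc ss (rotations g q (List.finRange N) ++ gs) i i := by
  have h := prod_settleWeight_mul_pairMoment_le_of_nodup huu huc hcc hss g q gs
    (List.finRange N) (List.nodup_finRange N) i
  simpa [Fin.prod_univ_def] using h

/-- The Pauli matrix `Z`, or the identity if `p` is the identity. -/
def zPart (p : Fin 4) : Fin 4 := if p = 0 then 0 else 3

theorem zPart_zPart (p : Fin 4) : zPart (zPart p) = zPart p := by revert p; decide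

theorem settle_settle (p : Fin 4) : settle false (settle true p) = zPart p := by
  revert p; decide

theorem not_isXY_zPart (p : Fin 4) : ¬IsXY (zPart p) := by revert p; decide

theorem pairMoment_cz_append (E : List (QubitPair N)) (gs : List (Gate N Q))
    {i : Fin N → Fin 4} (hi : ∀ n, ¬IsXY (i n)) :
    pairMoment uu uc cc ss (E.map cz ++ gs) i i = pairMoment uu uc cc ss gs i i := by
  induction E with
  | nil => rfl
  | cons p E ih =>
    have h : czMap p i = i := by funext n; simp [czMap, hi]
    rw [List.map_cons, List.cons_append, pairMoment, czSign_mul_self, h, one_mul, ih]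

/-- The gates of a block, the last gate first: the rotations about `Y` with parameters in row
`b.2.2`, the rotations about `X` with parameters in row `b.2.1`, and the controlled-`Z` gates. -/
def block (b : List (QubitPair N) × Q × Q) : List (Gate N Q) :=
  rotations true b.2.2 (List.finRange N) ++ rotations false b.2.1 (List.finRange N) ++ b.1.map cz

/-- The probability that a block turns each nontrivial factor of a Pauli string into `Z`. -/
noncomputable def blockWeight (uu cc ss : Q × Fin N → ℝ) (i : Fin N → Fin 4)
    (b : List (QubitPair N) × Q × Q) : ℝ :=
  (∏ n, settleWeight uu cc ss true (b.2.2, n) (i n)) *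
    ∏ n, settleWeight uu cc ss false (b.2.1, n) (settle true (i n))

theorem blockWeight_nonneg (huu : ∀ k, 0 ≤ uu k) (hcc : ∀ k, 0 ≤ cc k) (hss : ∀ k, 0 ≤ ss k)
    (i : Fin N → Fin 4) (b : List (QubitPair N) × Q × Q) : 0 ≤ blockWeight uu cc ss i b :=
  mul_nonneg (Finset.prod_nonneg fun _ _ => settleWeight_nonneg huu hcc hss _ _ _)
    (Finset.prod_nonneg fun _ _ => settleWeight_nonneg huu hcc hss _ _ _)

/-- The Y rotation sends X to Z and the X rotation sends Y to Z, so after both only I and Z are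
left, and the `CZ` gates fix such a string. -/
theorem blockWeight_mul_pairMoment_le (huu : ∀ k, 0 ≤ uu k) (huc : ∀ k, 0 ≤ uc k)
    (hcc : ∀ k, 0 ≤ cc k) (hss : ∀ k, 0 ≤ ss k) (b : List (QubitPair N) × Q × Q)
    (gs : List (Gate N Q)) (i : Fin N → Fin 4) :
    blockWeight uu cc ss i b *
        pairMoment uu uc cc ss gs (fun n => zPart (i n)) (fun n => zPart (i n)) ≤
      pairMoment uu uc cc ss (block b ++ gs) i i := by
  rw [block, List.append_assoc, List.append_assoc]
  refine le_trans ?_ (prod_settleWeight_mul_pairMoment_le huu huc hcc hss _ _ _ _)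
  rw [blockWeight, mul_assoc]
  refine mul_le_mul_of_nonneg_left ?_
    (Finset.prod_nonneg fun _ _ => settleWeight_nonneg huu hcc hss _ _ _)
  refine le_trans (le_of_eq ?_) (prod_settleWeight_mul_pairMoment_le huu huc hcc hss _ _ _ _)
  simp only [settle_settle]
  rw [pairMoment_cz_append _ _ fun n => not_isXY_zPart _]

theorem prod_blockWeight_le (huu : ∀ k, 0 ≤ uu k) (huc : ∀ k, 0 ≤ uc k)
    (hcc : ∀ k, 0 ≤ cc k) (hss : ∀ k, 0 ≤ ss k) (bs : List (List (QubitPair N) × Q × Q))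
    (i : Fin N → Fin 4) :
    (bs.map (blockWeight uu cc ss fun n => zPart (i n))).prod ≤
      pairMoment uu uc cc ss (bs.flatMap block) (fun n => zPart (i n)) (fun n => zPart (i n)) := by
  induction bs with
  | nil =>
    have h : ∀ n, zPart (i n) = 0 ∨ zPart (i n) = 3 := fun n => by
      unfold zPart; split_ifs <;> simp
    simp [pairMoment, baseValue, h]
  | cons b bs ih =>
    rw [List.map_cons, List.prod_cons, List.flatMap_cons]
    have h := blockWeight_mul_pairMoment_le huu huc hcc hss b (bs.flatMap block)
      (fun n => zPart (i n))
    simp only [zPart_zPart] at h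
    exact le_trans (mul_le_mul_of_nonneg_left ih (blockWeight_nonneg huu hcc hss _ _)) h

end Gate

end ReducedDomainVQE

namespace ReducedDomainVQE

/-! ### Moments of a uniformly distributed angle -/

/-- The uniform distribution on `[-aπ, aπ]`. -/
noncomputable def angleLaw (a : ℝ) : Measure ℝ :=
  ProbabilityTheory.cond volume (Set.Icc (-(a * Real.pi)) (a * Real.pi))

section

variable {a : ℝ}

theorem isProbabilityMeasure_angleLaw (ha : 0 < a) : IsProbabilityMeasure (angleLaw a) := by
  have hp : 0 < a * Real.pi := mul_pos ha Real.pi_pos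
  refine ProbabilityTheory.cond_isProbabilityMeasure_of_finite ?_ ?_
  · rw [Real.volume_Icc]
    simp only [ne_eq, ENNReal.ofReal_eq_zero, not_le]
    linarith
  · rw [Real.volume_Icc]
    exact ENNReal.ofReal_ne_top

theorem ae_angleLaw_mem (a : ℝ) :
    ∀ᵐ x ∂angleLaw a, x ∈ Set.Icc (-(a * Real.pi)) (a * Real.pi) :=
  ProbabilityTheory.ae_cond_mem measurableSet_Icc

theorem integral_angleLaw (ha : 0 < a) (f : ℝ → ℝ) :
    ∫ x, f x ∂angleLaw a =
      (2 * (a * Real.pi))⁻¹ * ∫ x in (-(a * Real.pi))..(a * Real.pi), f x := by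
  have hp : 0 < a * Real.pi := mul_pos ha Real.pi_pos
  rw [angleLaw, ProbabilityTheory.cond, integral_smul_measure, Real.volume_Icc,
    intervalIntegral.integral_of_le (by linarith), integral_Icc_eq_integral_Ioc, ENNReal.toReal_inv,
    ENNReal.toReal_ofReal (by linarith), smul_eq_mul]
  congr 2
  ring

theorem integral_cos_angleLaw (ha : 0 < a) :
    ∫ x, Real.cos x ∂angleLaw a = Real.sin (a * Real.pi) / (a * Real.pi) := by
  have hp : 0 < a * Real.pi := mul_pos ha Real.pi_pos
  rw [integral_angleLaw ha, integral_cos, Real.sin_neg]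
  field_simp
  ring

theorem integral_sin_angleLaw (ha : 0 < a) : ∫ x, Real.sin x ∂angleLaw a = 0 := by
  rw [integral_angleLaw ha, integral_sin, Real.cos_neg, sub_self, mul_zero]

theorem integral_sin_mul_cos_angleLaw (ha : 0 < a) :
    ∫ x, Real.sin x * Real.cos x ∂angleLaw a = 0 := by
  rw [integral_angleLaw ha, integral_sin_mul_cos₁, Real.sin_neg]
  ring

theorem integral_cos_mul_cos_angleLaw (ha : 0 < a) :
    ∫ x, Real.cos x * Real.cos x ∂angleLaw a = alphaCoeff a := by
  have hp : 0 < a * Real.pi := mul_pos ha Real.pi_pos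
  simp only [← pow_two]
  rw [integral_angleLaw ha, integral_cos_sq, Real.sin_neg, Real.cos_neg, alphaCoeff, mul_assoc,
    Real.sin_two_mul]
  field_simp
  ring

theorem integral_sin_mul_sin_angleLaw (ha : 0 < a) :
    ∫ x, Real.sin x * Real.sin x ∂angleLaw a = betaCoeff a := by
  have hp : 0 < a * Real.pi := mul_pos ha Real.pi_pos
  simp only [← pow_two]
  rw [integral_angleLaw ha, integral_sin_sq, Real.sin_neg, Real.cos_neg, betaCoeff, mul_assoc,
    Real.sin_two_mul]
  field_simp
  ring

theorem measurePreserving_neg_angleLaw (a : ℝ) :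
    MeasurePreserving (fun x : ℝ => -x) (angleLaw a) (angleLaw a) := by
  have hs : (fun x : ℝ => -x) ⁻¹' Set.Icc (-(a * Real.pi)) (a * Real.pi) =
      Set.Icc (-(a * Real.pi)) (a * Real.pi) := by
    ext x; simp only [Set.mem_preimage, Set.mem_Icc]; constructor <;> intro h <;>
      constructor <;> linarith [h.1, h.2]
  have h := (Measure.measurePreserving_neg (volume : Measure ℝ)).restrict_preimage
    (measurableSet_Icc (a := -(a * Real.pi)) (b := a * Real.pi))
  change MeasurePreserving (fun x : ℝ => -x) _ _ at h
  rw [show (Neg.neg : ℝ → ℝ) = fun x => -x from rfl, hs] at h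
  exact h.smul_measure _

theorem alphaCoeff_add_betaCoeff (a : ℝ) : alphaCoeff a + betaCoeff a = 1 := by
  unfold alphaCoeff betaCoeff; ring

theorem abs_sin_div_lt (ha : 0 < a) :
    |Real.sin (2 * a * Real.pi) / (a * Real.pi)| < 2 := by
  have hp : 0 < a * Real.pi := mul_pos ha Real.pi_pos
  rw [abs_div, abs_of_pos hp, div_lt_iff₀ hp, ← mul_assoc]
  have hpos : 0 < 2 * a * Real.pi := by positivity
  simpa [abs_of_pos hpos] using Real.abs_sin_lt_abs hpos.ne'

theorem alphaCoeff_pos (ha : 0 < a) : 0 < alphaCoeff a := by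
  have := (abs_lt.1 (abs_sin_div_lt ha)).1
  unfold alphaCoeff; linarith

theorem betaCoeff_pos (ha : 0 < a) : 0 < betaCoeff a := by
  have := (abs_lt.1 (abs_sin_div_lt ha)).2
  unfold betaCoeff; linarith

end

/-! ### The selected parameter -/

section

variable {S L : ℕ} {a : ℝ}

/-- With `betaCoeff_eq` this gives α : β = (2SL - 1) : (S + 1), the ratio maximizing α^(2SL-1)
β^(S+1) when α + β = 1. -/
theorem IsSelected.alphaCoeff_eq (h : IsSelected S L a) (hS : 1 ≤ S) :
    alphaCoeff a = (2 * S * L - 1) / (S * (2 * L + 1)) := by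
  obtain ⟨h0, -, h⟩ := h
  have hp : 0 < a * Real.pi := mul_pos h0 Real.pi_pos
  have hS' : (0 : ℝ) < S := by exact_mod_cast hS
  have e : Real.sin (2 * a * Real.pi) / (a * Real.pi) =
      2 * (Real.sin (2 * a * Real.pi) / (2 * a * Real.pi)) := by
    rw [mul_assoc 2 a]; field_simp
  rw [alphaCoeff, e, h]
  field_simp
  ring

theorem IsSelected.betaCoeff_eq (h : IsSelected S L a) (hS : 1 ≤ S) :
    betaCoeff a = (S + 1) / (S * (2 * L + 1)) := by
  have hS' : (0 : ℝ) < S := by exact_mod_cast hS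
  rw [← sub_eq_of_eq_add' (alphaCoeff_add_betaCoeff a).symm, h.alphaCoeff_eq hS]
  field_simp
  ring

/-- Here 1/α = 1 + (S+1)/(2SL-1) is at most exp((S+1)/(2SL-1)), so the power of α is at least
e^(-(S+1)). -/
theorem IsSelected.le_pow_mul_pow (h : IsSelected S L a) (hS : 1 ≤ S) (hL : 1 ≤ L) :
    (((S : ℝ) + 1) / (Real.exp 1 * (S : ℝ))) ^ (S + 1) *
        (1 / (2 * (L : ℝ) + 1) ^ (S + 1)) ≤
      alphaCoeff a ^ (2 * S * L - 1) * betaCoeff a ^ (S + 1) := by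
  have hS' : (0 : ℝ) < S := by exact_mod_cast hS
  have hn1 : 1 ≤ 2 * S * L := by nlinarith
  have hn2 : 1 ≤ 2 * S * L - 1 := by
    have : 1 ≤ S * L := Nat.mul_pos hS hL
    have : 2 * S * L = 2 * (S * L) := by ring
    omega
  have hcast : ((2 * S * L - 1 : ℕ) : ℝ) = 2 * S * L - 1 := by push_cast [hn1]; ring
  have hpos : (0 : ℝ) < 2 * S * L - 1 := by rw [← hcast]; exact_mod_cast hn2
  have hα : Real.exp (-((S + 1) / (2 * S * L - 1))) ≤ alphaCoeff a := by
    rw [h.alphaCoeff_eq hS, Real.exp_neg, inv_le_comm₀ (Real.exp_pos _) (by positivity), inv_div]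
    refine le_trans (le_of_eq ?_) (Real.add_one_le_exp _)
    rw [div_add_one hpos.ne']
    congr 1
    ring
  have hα' : Real.exp (-(S + 1)) ≤ alphaCoeff a ^ (2 * S * L - 1) := by
    refine le_trans (le_of_eq ?_) (pow_le_pow_left₀ (Real.exp_pos _).le hα _)
    rw [← Real.exp_nat_mul, hcast]
    congr 1
    generalize 2 * (S : ℝ) * L - 1 = n at *
    field_simp
  have e : (((S : ℝ) + 1) / (Real.exp 1 * (S : ℝ))) ^ (S + 1) *
      (1 / (2 * (L : ℝ) + 1) ^ (S + 1)) = Real.exp (-(S + 1)) * betaCoeff a ^ (S + 1) := by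
    rw [h.betaCoeff_eq hS, show -((S : ℝ) + 1) = ((S + 1 : ℕ) : ℝ) * (-1) by push_cast; ring,
      Real.exp_nat_mul, Real.exp_neg, ← one_div_pow, ← mul_pow, ← mul_pow]
    congr 1
    field_simp
  rw [e]
  exact mul_le_mul_of_nonneg_right hα' (pow_nonneg (betaCoeff_pos h.1).le _)

/-- For L ≥ 2 the right-hand side of the equation is positive, and the sine is nonpositive on [π,
2π]. -/
theorem IsSelected.lt_pi (h : IsSelected S L a) (hS : 1 ≤ S) (hL : 2 ≤ L) :
    2 * a * Real.pi < Real.pi := by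
  obtain ⟨h0, h1, h⟩ := h
  have hS' : (1 : ℝ) ≤ S := by exact_mod_cast hS
  have hL' : (2 : ℝ) ≤ L := by exact_mod_cast hL
  have hx : 0 < 2 * a * Real.pi := by have := Real.pi_pos; positivity
  have hr : 0 < ((S : ℝ) * (2 * (L : ℝ) - 1) - 2) / ((S : ℝ) * (2 * (L : ℝ) + 1)) := by
    refine div_pos ?_ (by positivity)
    nlinarith
  rw [← h] at hr
  have hs : 0 < Real.sin (2 * a * Real.pi) := by
    by_contra hs
    exact absurd (div_nonpos_of_nonpos_of_nonneg (not_lt.1 hs) hx.le) (not_le.2 hr)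
  by_contra hlt
  have hle : Real.pi ≤ 2 * a * Real.pi := not_lt.1 hlt
  have h2 : 0 ≤ Real.sin (2 * a * Real.pi - Real.pi) :=
    Real.sin_nonneg_of_nonneg_of_le_pi (by linarith) (by nlinarith [Real.pi_pos])
  rw [Real.sin_sub_pi] at h2
  linarith

/-- Chord slopes from the origin decrease because the sine is strictly concave on [0, π]. -/
theorem sin_div_lt_sin_div {x y : ℝ} (hx : 0 < x) (hxy : x < y) (hy : y ≤ Real.pi) :
    Real.sin y / y < Real.sin x / x := by
  have hy0 : 0 < y := hx.trans hxy
  have h := strictConcaveOn_sin_Icc.2 ⟨le_rfl, Real.pi_pos.le⟩ ⟨hy0.le, hy⟩ hy0.ne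
    (sub_pos.2 ((div_lt_one hy0).2 hxy)) (div_pos hx hy0) (sub_add_cancel 1 (x / y))
  simp only [smul_eq_mul, Real.sin_zero, mul_zero, zero_add, div_mul_cancel₀ _ hy0.ne'] at h
  rw [lt_div_iff₀ hx]
  calc Real.sin y / y * x = x / y * Real.sin y := by ring
    _ < _ := h

theorem existsUnique_isSelected (hS : 1 ≤ S) (hL : 2 ≤ L) : ∃! a : ℝ, IsSelected S L a := by
  have hS' : (1 : ℝ) ≤ S := by exact_mod_cast hS
  have hL' : (2 : ℝ) ≤ L := by exact_mod_cast hL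
  have hpi := Real.pi_pos
  set r := ((S : ℝ) * (2 * (L : ℝ) - 1) - 2) / ((S : ℝ) * (2 * (L : ℝ) + 1)) with hr
  have hr0 : 0 < r := div_pos (by nlinarith) (by positivity)
  have hr1 : r < 1 := (div_lt_one (by positivity)).2 (by nlinarith)
  have hex : ∃ x ∈ Set.Icc 0 Real.pi, Real.sinc x = r := by
    have h := intermediate_value_Icc' hpi.le Real.continuous_sinc.continuousOn
    refine h ⟨?_, ?_⟩
    · rw [Real.sinc_of_ne_zero hpi.ne', Real.sin_pi, zero_div]; exact hr0.le
    · rw [Real.sinc_zero]; exact hr1.le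
  obtain ⟨x, ⟨hx0, hxpi⟩, hx⟩ := hex
  have hx0' : x ≠ 0 := by rintro rfl; rw [Real.sinc_zero] at hx; exact hr1.ne' hx
  have hxpos : 0 < x := lt_of_le_of_ne hx0 hx0'.symm
  have hxe : 2 * (x / (2 * Real.pi)) * Real.pi = x := by field_simp
  refine ⟨x / (2 * Real.pi), ⟨by positivity, ?_, ?_⟩, ?_⟩
  · rw [div_lt_one (by positivity)]; linarith
  · rw [hxe, ← Real.sinc_of_ne_zero hx0', hx]
  · intro b hb
    have hbpi := hb.lt_pi hS hL
    have hbpos : 0 < 2 * b * Real.pi := by have := hb.1; positivity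
    have hbeq : Real.sin (2 * b * Real.pi) / (2 * b * Real.pi) = Real.sin x / x := by
      rw [hb.2.2, ← hr, ← hx, Real.sinc_of_ne_zero hx0']
    have : 2 * b * Real.pi = x := by
      rcases lt_trichotomy (2 * b * Real.pi) x with h | h | h
      · exact absurd hbeq (sin_div_lt_sin_div hbpos h hxpi).ne'
      · exact h
      · exact absurd hbeq (sin_div_lt_sin_div hxpos h hbpi.le).ne
    rw [← this]; field_simp

theorem mul_cos_le_sin {x : ℝ} (hx : 0 ≤ x) (hx' : x ≤ Real.pi) : x * Real.cos x ≤ Real.sin x := by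
  rcases lt_or_ge x (Real.pi / 2) with h | h
  · have hc : 0 < Real.cos x := Real.cos_pos_of_mem_Ioo ⟨by linarith, h⟩
    have ht := Real.le_tan hx h
    rwa [Real.tan_eq_sin_div_cos, le_div_iff₀ hc] at ht
  · have hc : Real.cos x ≤ 0 := Real.cos_nonpos_of_pi_div_two_le_of_le h (by linarith)
    exact (mul_nonpos_of_nonneg_of_nonpos hx hc).trans (Real.sin_nonneg_of_nonneg_of_le_pi hx hx')

/-- The quantity 1 - sin(2aπ)/(2aπ) equals (2S+2)/(S(2L+1)), which lies between 2/(3L) and 2/L. It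
also lies between 2a² and 2(aπ)², hence a² is of order 1/L. -/
theorem IsSelected.sq_le (h : IsSelected S L a) (hS : 1 ≤ S) (hL : 2 ≤ L) :
    a ^ 2 ≤ 1 / L ∧ 1 / L ≤ 36 * a ^ 2 := by
  have hS' : (1 : ℝ) ≤ S := by exact_mod_cast hS
  have hL' : (2 : ℝ) ≤ L := by exact_mod_cast hL
  have hpi := Real.pi_pos
  have hlt := h.lt_pi hS hL
  obtain ⟨h0, -, h⟩ := h
  have hx : 0 < 2 * a * Real.pi := by positivity
  have hD : Real.sin (2 * a * Real.pi) / (2 * a * Real.pi) =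
      1 - (2 * S + 2) / (S * (2 * L + 1)) := by
    rw [h]; field_simp; ring
  have hD1 : (2 * (S : ℝ) + 2) / (S * (2 * L + 1)) ≤ 2 / L := by
    rw [div_le_div_iff₀ (by positivity) (by positivity)]; nlinarith
  have hD2 : 2 / (3 * (L : ℝ)) ≤ (2 * (S : ℝ) + 2) / (S * (2 * L + 1)) := by
    rw [div_le_div_iff₀ (by positivity) (by positivity)]; nlinarith
  -- Doubling the angle reduces this to sin x ≤ x and a quadratic bound for cos x at x = aπ.
  have hup : Real.sin (2 * a * Real.pi) / (2 * a * Real.pi) ≤ 1 - 2 * a ^ 2 := by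
    have e : Real.sin (2 * a * Real.pi) =
        2 * Real.sin (a * Real.pi) * Real.cos (a * Real.pi) := by
      rw [← Real.sin_two_mul]; congr 1; ring
    have hc : 0 ≤ Real.cos (a * Real.pi) :=
      Real.cos_nonneg_of_mem_Icc ⟨by nlinarith, by linarith⟩
    have hs : Real.sin (a * Real.pi) ≤ a * Real.pi := Real.sin_le (by positivity)
    have hq : Real.cos (a * Real.pi) ≤ 1 - 2 / Real.pi ^ 2 * (a * Real.pi) ^ 2 :=
      Real.cos_le_one_sub_mul_cos_sq (by rw [abs_of_pos (by positivity)]; linarith)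
    have hq' : 2 / Real.pi ^ 2 * (a * Real.pi) ^ 2 = 2 * a ^ 2 := by field_simp
    rw [div_le_iff₀ hx, e]
    rw [hq'] at hq
    calc 2 * Real.sin (a * Real.pi) * Real.cos (a * Real.pi)
        ≤ 2 * (a * Real.pi) * Real.cos (a * Real.pi) := by gcongr
      _ ≤ 2 * (a * Real.pi) * (1 - 2 * a ^ 2) := by gcongr
      _ = _ := by ring
  have hlow : 1 - 2 * (a * Real.pi) ^ 2 ≤
      Real.sin (2 * a * Real.pi) / (2 * a * Real.pi) := by
    rw [le_div_iff₀ hx]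
    refine le_trans ?_ (mul_cos_le_sin hx.le hlt.le)
    rw [mul_comm]
    refine mul_le_mul_of_nonneg_left (le_trans (le_of_eq ?_) Real.one_sub_sq_div_two_le_cos) hx.le
    ring
  constructor
  · have : 2 * a ^ 2 ≤ 2 / L := by linarith
    have e : (2 : ℝ) / L = 2 * (1 / L) := by ring
    linarith
  · have h1 : 2 / (3 * (L : ℝ)) ≤ 2 * (a * Real.pi) ^ 2 := by linarith
    have e : (2 : ℝ) / (3 * L) = 2 / 3 * (1 / L) := by field_simp
    -- Then 2/(3L) ≤ 24a², which is where 36 comes from.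
    have hpi2 : Real.pi ^ 2 ≤ 12 := by nlinarith [Real.pi_lt_d2]
    have : (a * Real.pi) ^ 2 ≤ 12 * a ^ 2 := by rw [mul_pow]; nlinarith [sq_nonneg a]
    rw [e] at h1
    linarith

theorem isTheta_of_isSelected (hS : 1 ≤ S) {a : ℕ → ℝ}
    (ha : ∀ L : ℕ, 2 ≤ L → IsSelected S L (a L)) :
    a =Θ[atTop] fun L : ℕ => 1 / Real.sqrt (L : ℝ) := by
  have hsq : ∀ L : ℕ, (1 / Real.sqrt (L : ℝ)) ^ 2 = 1 / L := fun L => by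
    rw [div_pow, one_pow, Real.sq_sqrt (Nat.cast_nonneg L)]
  constructor
  · refine IsBigO.of_bound 1 ?_
    filter_upwards [eventually_ge_atTop 2] with L hL
    have h := (ha L hL).sq_le hS hL
    rw [one_mul, Real.norm_of_nonneg (ha L hL).1.le, Real.norm_of_nonneg (by positivity)]
    exact (sq_le_sq₀ (ha L hL).1.le (by positivity)).1 (by rw [hsq]; exact h.1)
  · refine IsBigO.of_bound 6 ?_
    filter_upwards [eventually_ge_atTop 2] with L hL
    have h := (ha L hL).sq_le hS hL
    rw [Real.norm_of_nonneg (ha L hL).1.le, Real.norm_of_nonneg (by positivity)]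
    refine (sq_le_sq₀ (by positivity) (mul_nonneg (by norm_num) (ha L hL).1.le)).1 ?_
    rw [hsq, mul_pow]; linarith [h.2]

end

/-! ### Polynomial and exponential bounds -/

theorem polynomial_eval_le (P : Polynomial ℕ) {m : ℕ} (hm : 1 ≤ m) :
    P.eval m ≤ P.eval 1 * m ^ P.natDegree := by
  rw [Polynomial.eval_eq_sum_range, Polynomial.eval_eq_sum_range, Finset.sum_mul]
  refine Finset.sum_le_sum fun i hi => ?_
  rw [one_pow, mul_one]
  exact Nat.mul_le_mul_left _
    (Nat.pow_le_pow_right hm (Nat.lt_succ_iff.1 (Finset.mem_range.1 hi)))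

theorem polynomiallyLarge_of_le {m L : ℕ → ℕ} (hm : Tendsto m atTop atTop) (P : Polynomial ℕ)
    (hL : ∀ k, L k ≤ P.eval (m k)) {c : ℝ} (hc : 0 < c) (r : ℕ) {f : ℕ → ℝ}
    (hf : ∀ k, c * (1 / (2 * (L k : ℝ) + 1) ^ r) ≤ f k) : PolynomiallyLarge m f := by
  set A : ℝ := 2 * (P.eval 1 : ℕ) + 1 with hA
  have hA0 : 0 < A := by positivity
  refine ⟨P.natDegree * r, IsBigO.of_bound (A ^ r / c) ?_⟩
  filter_upwards [hm.eventually_ge_atTop 1] with k hk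
  have hk' : (1 : ℝ) ≤ m k := by exact_mod_cast hk
  have hmk : (1 : ℝ) ≤ (m k : ℝ) ^ P.natDegree := one_le_pow₀ hk'
  have h1 : 2 * (L k : ℝ) + 1 ≤ A * (m k : ℝ) ^ P.natDegree := by
    have : (L k : ℝ) ≤ (P.eval 1 : ℕ) * (m k : ℝ) ^ P.natDegree := by
      exact_mod_cast (hL k).trans (polynomial_eval_le P hk)
    rw [hA]; nlinarith
  have h2 : (2 * (L k : ℝ) + 1) ^ r ≤ A ^ r * (m k : ℝ) ^ (P.natDegree * r) := by
    rw [pow_mul, ← mul_pow]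
    exact pow_le_pow_left₀ (by positivity) h1 r
  have hf0 : 0 ≤ f k := le_trans (by positivity) (hf k)
  rw [Real.norm_of_nonneg (by positivity), Real.norm_of_nonneg hf0]
  have h3 : A ^ r / c * (c * (1 / (2 * (L k : ℝ) + 1) ^ r)) ≤ A ^ r / c * f k :=
    mul_le_mul_of_nonneg_left (hf k) (by positivity)
  refine le_trans ?_ h3
  have e : A ^ r / c * (c * (1 / (2 * (L k : ℝ) + 1) ^ r)) =
      A ^ r / (2 * (L k : ℝ) + 1) ^ r := by field_simp
  rw [e, div_le_div_iff₀ (by positivity) (by positivity), one_mul]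
  exact h2

/-- Otherwise 1 ≤ C m^d b^m eventually, although the right-hand side tends to 0. -/
theorem PolynomiallyLarge.not_isBigO {m : ℕ → ℕ} {f : ℕ → ℝ} (hm : Tendsto m atTop atTop)
    (hf : PolynomiallyLarge m f) {b : ℝ} (hb0 : 0 < b) (hb1 : b < 1) :
    ¬f =O[atTop] fun k => b ^ m k := by
  intro h
  obtain ⟨d, hd⟩ := hf
  obtain ⟨C, hC⟩ := (hd.trans h).bound
  have hlim : Tendsto (fun k => C * ((m k : ℝ) ^ d * b ^ m k)) atTop (nhds (C * 0)) :=
    ((tendsto_pow_const_mul_const_pow_of_lt_one d hb0.le hb1).comp hm).const_mul C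
  rw [mul_zero] at hlim
  obtain ⟨k, hk1, hk2, hk3⟩ := (hC.and ((hlim.eventually_lt_const one_pos).and
    (hm.eventually_ge_atTop 1))).exists
  have hmk : (0 : ℝ) < m k := by exact_mod_cast hk3
  rw [Real.norm_of_nonneg (by positivity), Real.norm_of_nonneg (by positivity),
    div_le_iff₀ (by positivity)] at hk1
  linarith [mul_assoc C (b ^ m k) ((m k : ℝ) ^ d), mul_comm (b ^ m k) ((m k : ℝ) ^ d),
    mul_assoc C ((m k : ℝ) ^ d) (b ^ m k)]

end ReducedDomainVQE

namespace ReducedDomainVQE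

namespace Gate

variable {N : ℕ} {Q : Type*}

/-! ### The circuit as a sequence of gates -/

theorem params_append (gs hs : List (Gate N Q)) : params (gs ++ hs) = params gs ++ params hs := by
  induction gs with
  | nil => rfl
  | cons G gs ih => cases G <;> simp [params, ih]

theorem params_rotations (g : Bool) (q : Q) (l : List (Fin N)) :
    params (rotations g q l) = l.map (Prod.mk q) := by
  induction l with
  | nil => rfl
  | cons n l ih => simpa [rotations, params] using ih

theorem params_block (b : List (QubitPair N) × Q × Q) :
    params (block b) =
      (List.finRange N).map (Prod.mk b.2.2) ++ (List.finRange N).map (Prod.mk b.2.1) := by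
  have h : ∀ E : List (QubitPair N), params (E.map (cz (Q := Q))) = [] := by
    intro E
    induction E with
    | nil => rfl
    | cons p E ih => simpa [params] using ih
  rw [block, params_append, params_append, params_rotations, params_rotations, h, List.append_nil]

theorem params_flatMap_block (bs : List (List (QubitPair N) × Q × Q)) :
    params (bs.flatMap block) = bs.flatMap fun b => params (block b) := by
  induction bs with
  | nil => rfl
  | cons b bs ih => rw [List.flatMap_cons, List.flatMap_cons, params_append, ih]

theorem mem_params_block {b : List (QubitPair N) × Q × Q} {k : Q × Fin N} :
    k ∈ params (block b) ↔ k.1 = b.2.2 ∨ k.1 = b.2.1 := by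
  obtain ⟨q, n⟩ := k
  simp [params_block, eq_comm]

theorem rotationLayer_eq (g : Bool) (q : Q) (θ : Q × Fin N → ℝ) :
    rotationLayer (pauli (axis g)) (fun n => θ (q, n)) =
      ((rotations g q (List.finRange N)).map (op θ)).prod := by
  have h := prod_single_eq_tensor (fun n => pauliRotation (pauli (axis g)) (θ (q, n)))
    (List.finRange N) (List.nodup_finRange N)
  simp only [List.mem_finRange, if_true] at h
  rw [rotationLayer, ← h, rotations, List.map_map]
  rfl

theorem prod_map_op_block (b : List (QubitPair N) × Q × Q) (θ : Q × Fin N → ℝ) :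
    ((block b).map (op θ)).prod =
      rotationLayer (pauli 2) (fun n => θ (b.2.2, n)) *
        rotationLayer (pauli 1) (fun n => θ (b.2.1, n)) * czLayer b.1 := by
  rw [block, List.map_append, List.map_append, List.prod_append, List.prod_append,
    ← rotationLayer_eq, ← rotationLayer_eq, List.map_map, czLayer]
  rfl

/-- The entanglement layer and the parameter rows of the `l`-th block. -/
def blockData {L : ℕ} (layer : Fin L → List (QubitPair N)) (l : Fin L) :
    List (QubitPair N) × Fin (2 * L) × Fin (2 * L) :=
  (layer l, ⟨2 * l, by omega⟩, ⟨2 * l + 1, by omega⟩)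

/-- The gates of a circuit, the last gate first. -/
def circuitGates {L : ℕ} (layer : Fin L → List (QubitPair N)) : List (Gate N (Fin (2 * L))) :=
  (List.ofFn (blockData layer)).reverse.flatMap block

theorem nodup_params_circuitGates {L : ℕ} (layer : Fin L → List (QubitPair N)) :
    (params (circuitGates layer)).Nodup := by
  rw [circuitGates, params_flatMap_block, List.nodup_flatMap]
  constructor
  · intro b hb
    rw [List.mem_reverse, List.mem_ofFn] at hb
    obtain ⟨l, rfl⟩ := hb
    rw [params_block, List.nodup_append]
    refine ⟨(List.nodup_finRange N).map (Prod.mk_right_injective _),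
      (List.nodup_finRange N).map (Prod.mk_right_injective _), ?_⟩
    simp [blockData]
  · rw [List.pairwise_reverse, List.pairwise_ofFn]
    intro l l' hl k hk hk'
    rw [mem_params_block] at hk hk'
    simp only [blockData, Fin.ext_iff] at hk hk'
    have : (l : ℕ) < l' := hl
    omega

theorem mem_params_circuitGates {L : ℕ} (layer : Fin L → List (QubitPair N))
    (v : Fin (2 * L) × Fin N) : v ∈ params (circuitGates layer) := by
  rw [circuitGates, params_flatMap_block, List.mem_flatMap]
  -- Block `l` owns rows `2 * l` and `2 * l + 1`, so halving the row finds the block.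
  refine ⟨blockData layer ⟨v.1 / 2, by omega⟩, ?_, ?_⟩
  · rw [List.mem_reverse, List.mem_ofFn]
    exact ⟨_, rfl⟩
  · rw [mem_params_block]
    simp only [blockData, Fin.ext_iff]
    omega

theorem prod_map_op_circuitGates {L : ℕ} (layer : Fin L → List (QubitPair N))
    (θ : Fin (2 * L) × Fin N → ℝ) :
    ((circuitGates layer).map (op θ)).prod =
      (List.ofFn fun l => ((block (blockData layer l)).map (op θ)).prod).reverse.prod := by
  have h : ∀ bs : List (List (QubitPair N) × Fin (2 * L) × Fin (2 * L)),
      ((bs.flatMap block).map (op θ)).prod =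
        (bs.map fun b => ((block b).map (op θ)).prod).prod := by
    intro bs
    induction bs with
    | nil => rfl
    | cons b bs ih =>
      rw [List.flatMap_cons, List.map_append, List.prod_append, ih, List.map_cons, List.prod_cons]
  rw [circuitGates, h, List.map_reverse, List.map_ofFn]
  rfl

theorem measurePreserving_reflect [Fintype Q] (m : Fin N) {a : ℝ} (ha : 0 < a) :
    MeasurePreserving (reflect (Q := Q) m) (Measure.pi fun _ => angleLaw a)
      (Measure.pi fun _ => angleLaw a) := by
  have := isProbabilityMeasure_angleLaw ha
  refine measurePreserving_pi (f := fun (k : Q × Fin N) x => if k.2 = m then -x else x)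
    (fun _ => angleLaw a) (fun _ => angleLaw a) fun k => ?_
  by_cases hk : k.2 = m
  · simpa only [hk, if_true] using measurePreserving_neg_angleLaw a
  · simp only [hk, if_false]
    exact MeasurePreserving.id _

/-! ### Weights of the differentiated circuit -/

variable {v : Q × Fin N} [DecidableEq Q]

/-- The weights of the derivative of an expectation with respect to the parameter `v`. -/
noncomputable def derivWeight (v k : Q × Fin N) : ℝ → ℝ × ℝ × ℝ := if k = v then trigDeriv else trig

theorem continuous_derivWeight (v k : Q × Fin N) : Continuous (derivWeight v k) := by
  unfold derivWeight
  split_ifs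
  · exact continuous_const.prodMk (Real.continuous_sin.neg.prodMk Real.continuous_cos)
  · exact continuous_const.prodMk (Real.continuous_cos.prodMk Real.continuous_sin)

/-- The second moment of the derivative of a pair of expectations with respect to `v`. -/
noncomputable def derivMoment (a : ℝ) (v : Q × Fin N) (gs : List (Gate N Q))
    (i j : Fin N → Fin 4) : ℝ :=
  pairMoment (fun k => if k = v then 0 else 1)
    (fun k => if k = v then 0 else Real.sin (a * Real.pi) / (a * Real.pi))
    (fun k => if k = v then betaCoeff a else alphaCoeff a)
    (fun k => if k = v then alphaCoeff a else betaCoeff a) gs i j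

/-- At `v` the weights (0, -sin, cos) kill the invariant part and interchange α and β. -/
theorem integral_expect_mul_expect [Fintype Q] {a : ℝ} (ha : 0 < a) (v : Q × Fin N)
    (gs : List (Gate N Q)) (hgs : (params gs).Nodup) (i j : Fin N → Fin 4) :
    ∫ θ, expect (fun k => derivWeight v k (θ k)) gs i * expect (fun k => derivWeight v k (θ k)) gs j
        ∂(Measure.pi fun _ : Q × Fin N => angleLaw a) = derivMoment a v gs i j := by
  have := isProbabilityMeasure_angleLaw ha
  have h := integral_prod_mul_expect_mul_expect isCompact_Icc (ae_angleLaw_mem a)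
    (continuous_derivWeight v) (uu := fun k => if k = v then 0 else 1)
    (uc := fun k => if k = v then 0 else Real.sin (a * Real.pi) / (a * Real.pi))
    (cc := fun k => if k = v then betaCoeff a else alphaCoeff a)
    (ss := fun k => if k = v then alphaCoeff a else betaCoeff a)
    (fun k => by
      by_cases hk : k = v <;> simp [derivWeight, hk, trig, trigDeriv])
    (fun k => by
      by_cases hk : k = v <;>
        simp [derivWeight, hk, trig, trigDeriv, integral_cos_angleLaw ha])
    (fun k => by
      by_cases hk : k = v <;> simp [derivWeight, hk, trig, trigDeriv,
        integral_cos_mul_cos_angleLaw ha, integral_sin_mul_sin_angleLaw ha])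
    (fun k => by
      by_cases hk : k = v <;> simp [derivWeight, hk, trig, trigDeriv,
        integral_cos_mul_cos_angleLaw ha, integral_sin_mul_sin_angleLaw ha])
    (fun k => by
      by_cases hk : k = v <;>
        simp [derivWeight, hk, trig, trigDeriv, integral_sin_angleLaw ha])
    (fun k => by
      by_cases hk : k = v
      · simp [derivWeight, hk, trigDeriv, integral_neg, integral_sin_mul_cos_angleLaw ha]
      · simp [derivWeight, hk, trig, mul_comm (Real.cos _), integral_sin_mul_cos_angleLaw ha])
    gs hgs (fun _ _ => 1) (fun _ => continuous_const) (fun _ _ => rfl) i j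
  simpa [derivMoment] using h

/-- The condition a < 1 enters through the mean of the cosine, sin(aπ)/(aπ), which must be
nonnegative. -/
theorem derivMoment_nonneg {a : ℝ} (h0 : 0 < a) (h1 : a < 1) (v : Q × Fin N) (gs : List (Gate N Q))
    (i j : Fin N → Fin 4) : 0 ≤ derivMoment a v gs i j := by
  have hα := (alphaCoeff_pos h0).le
  have hβ := (betaCoeff_pos h0).le
  have hs : 0 ≤ Real.sin (a * Real.pi) / (a * Real.pi) :=
    div_nonneg (Real.sin_nonneg_of_nonneg_of_le_pi (by have := Real.pi_pos; positivity)
      (by nlinarith [Real.pi_pos])) (by have := Real.pi_pos; positivity)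
  refine pairMoment_nonneg ?_ ?_ ?_ ?_ gs i j <;> intro k <;> by_cases hk : k = v <;>
    simp [hk, hα, hβ, hs]

/-! ### Lower bound for the second moment of the derivative of a Pauli string -/

theorem settle_zPart (g : Bool) (p : Fin 4) : settle g (zPart p) = zPart p := by
  revert g p; decide

theorem prod_settleWeight_zPart {α β : ℝ} (hα : α ≠ 0) (g : Bool) (q : Q) (i : Fin N → Fin 4)
    (hi : i v.2 ≠ 0) :
    ∏ n, settleWeight (fun k => if k = v then 0 else 1) (fun k => if k = v then β else α)
        (fun k => if k = v then α else β) g (q, n) (zPart (i n)) =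
      α ^ locality i * if q = v.1 then β / α else 1 := by
  have hsite : ∀ n, settleWeight (fun k => if k = v then 0 else 1)
      (fun k => if k = v then β else α) (fun k => if k = v then α else β) g (q, n) (zPart (i n)) =
      (if i n ≠ 0 then α else 1) * if n = v.2 then (if q = v.1 then β / α else 1) else 1 := by
    intro n
    have hF : ¬Fixed g 3 := by revert g; decide
    have hF0 : Fixed g 0 := Or.inl rfl
    by_cases hn : n = v.2
    · subst hn
      by_cases hq : q = v.1
      · subst hq
        simp [settleWeight, zPart, hi, hF, mul_div_cancel₀, hα]
      · have : (q, v.2) ≠ v := fun h => hq (congrArg Prod.fst h)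
        simp [settleWeight, zPart, hi, hF, this, hq]
    · have : (q, n) ≠ v := fun h => hn (congrArg Prod.snd h)
      by_cases h0 : i n = 0 <;> simp [settleWeight, zPart, h0, hF, hF0, this, hn]
  simp only [hsite]
  rw [Finset.prod_mul_distrib, Finset.prod_ite_eq' Finset.univ v.2 fun _ => _,
    if_pos (Finset.mem_univ _), Finset.prod_ite, Finset.prod_const_one, mul_one,
    Finset.prod_const]
  rfl

/-- Per site, X costs αβ, Y costs β and Z costs α², all at least α²β. The block must not contain
`v`: an invariant factor at the differentiated rotation would have weight 0. -/
theorem pow_le_blockWeight {α β : ℝ} (hα0 : 0 < α) (hα1 : α ≤ 1) (hβ0 : 0 < β) (hβ1 : β ≤ 1)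
    (b : List (QubitPair N) × Q × Q) (hX : b.2.1 ≠ v.1) (hY : b.2.2 ≠ v.1) (i : Fin N → Fin 4) :
    (α ^ 2 * β) ^ locality i ≤ blockWeight (fun k => if k = v then 0 else 1)
      (fun k => if k = v then β else α) (fun k => if k = v then α else β) i b := by
  have hpow : (α ^ 2 * β) ^ locality i = ∏ n, if i n ≠ 0 then α ^ 2 * β else 1 := by
    rw [Finset.prod_ite, Finset.prod_const_one, mul_one, Finset.prod_const]
    rfl
  rw [hpow, blockWeight, ← Finset.prod_mul_distrib]
  refine Finset.prod_le_prod (fun n _ => by split_ifs <;> positivity) fun n _ => ?_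
  have h1 : ∀ n, (b.2.1, n) ≠ v := fun n h => hX (congrArg Prod.fst h)
  have h2 : ∀ n, (b.2.2, n) ≠ v := fun n h => hY (congrArg Prod.fst h)
  have hαβ : α * β ≤ 1 := mul_le_one₀ hα1 hβ0.le hβ1
  have hα2 : α ^ 2 ≤ 1 := pow_le_one₀ hα0.le hα1
  simp only [settleWeight, settle, h1, h2, if_false]
  generalize i n = p
  fin_cases p <;> simp [Fixed, axis]
  · nlinarith [mul_pos hα0 hβ0]
  · exact mul_le_of_le_one_left hβ0.le hα2
  · nlinarith

theorem derivMoment_ge {a : ℝ} (h0 : 0 < a) (h1 : a < 1) {S L : ℕ}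
    (layer : Fin L → List (QubitPair N)) (v : Fin (2 * L) × Fin N)
    (hv : (v.1 : ℕ) + 1 ≤ 2 * L - 2) (i : Fin N → Fin 4) (hi : i v.2 ≠ 0) (hiS : locality i ≤ S) :
    alphaCoeff a ^ (2 * S * L - 1) * betaCoeff a ^ (S + 1) ≤
      derivMoment a v (circuitGates layer) i i := by
  have hα0 := alphaCoeff_pos h0
  have hβ0 := betaCoeff_pos h0
  have hs : 0 ≤ Real.sin (a * Real.pi) / (a * Real.pi) :=
    div_nonneg (Real.sin_nonneg_of_nonneg_of_le_pi (by have := Real.pi_pos; positivity)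
      (by nlinarith [Real.pi_pos])) (by have := Real.pi_pos; positivity)
  have hsum := alphaCoeff_add_betaCoeff a
  unfold derivMoment
  generalize alphaCoeff a = α at *
  generalize betaCoeff a = β at *
  generalize Real.sin (a * Real.pi) / (a * Real.pi) = σ at *
  have hα1 : α ≤ 1 := by linarith
  have hβ1 : β ≤ 1 := by linarith
  -- From here on `L` counts the blocks other than the last one.
  obtain ⟨L, rfl⟩ : ∃ M, L = M + 1 := ⟨L - 1, by omega⟩
  have huu : ∀ k : Fin (2 * (L + 1)) × Fin N, (0 : ℝ) ≤ if k = v then 0 else 1 := fun k => by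
    split_ifs <;> norm_num
  have huc : ∀ k : Fin (2 * (L + 1)) × Fin N, 0 ≤ if k = v then 0 else σ := fun k => by
    split_ifs <;> simp [hs]
  have hcc : ∀ k : Fin (2 * (L + 1)) × Fin N, 0 ≤ if k = v then β else α := fun k => by
    split_ifs <;> positivity
  have hss : ∀ k : Fin (2 * (L + 1)) × Fin N, 0 ≤ if k = v then α else β := fun k => by
    split_ifs <;> positivity
  have hs1 : 1 ≤ locality i :=
    Finset.card_pos.2 ⟨v.2, Finset.mem_filter.2 ⟨Finset.mem_univ _, hi⟩⟩
  set s := locality i with hs_def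
  rw [circuitGates, List.ofFn_succ', List.concat_eq_append, List.reverse_append,
    List.reverse_singleton, List.singleton_append, List.flatMap_cons]
  refine le_trans ?_ (blockWeight_mul_pairMoment_le huu huc hcc hss _ _ i)
  -- The bound `hv` on the row keeps `v` out of the last block, so Z has already been reached when
  -- the differentiated rotation is met.
  have hlast := pow_le_blockWeight (v := v) hα0 hα1 hβ0 hβ1 (blockData layer (Fin.last L))
    (by simp only [blockData, Fin.val_last, ne_eq, Fin.ext_iff]; omega)
    (by simp only [blockData, Fin.val_last, ne_eq, Fin.ext_iff]; omega) i
  have hrest := prod_blockWeight_le huu huc hcc hss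
    (List.ofFn fun l : Fin L => blockData layer l.castSucc).reverse i
  have hprod : ((List.ofFn fun l : Fin L => blockData layer l.castSucc).reverse.map
      (blockWeight (fun k => if k = v then 0 else 1) (fun k => if k = v then β else α)
        (fun k => if k = v then α else β) fun n => zPart (i n))).prod =
      α ^ (2 * s * L) * (β / α) := by
    rw [List.map_reverse, List.prod_reverse, List.map_ofFn, List.prod_ofFn]
    have hl : ∀ l : Fin L, (blockWeight (fun k => if k = v then 0 else 1)
        (fun k => if k = v then β else α) (fun k => if k = v then α else β) fun n => zPart (i n))
          (blockData layer l.castSucc) =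
        α ^ (2 * s) * if l = ⟨v.1 / 2, by omega⟩ then β / α else 1 := by
      intro l
      simp only [blockWeight, settle_zPart]
      rw [prod_settleWeight_zPart hα0.ne' _ _ _ hi, prod_settleWeight_zPart hα0.ne' _ _ _ hi]
      simp only [blockData, Fin.val_castSucc, Fin.ext_iff]
      rw [two_mul s, pow_add]
      -- The parity of the row tells whether the factor β/α comes from the X or the Y rotations of
      -- its block.
      rcases Nat.even_or_odd' (v.1 : ℕ) with ⟨c, hc | hc⟩
      · rw [if_neg (by omega)]
        by_cases h : (l : ℕ) = v.1 / 2
        · rw [if_pos (by omega), if_pos h]; ring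
        · rw [if_neg (by omega), if_neg h]; ring
      · rw [if_neg (c := 2 * (l : ℕ) = v.1) (by omega)]
        by_cases h : (l : ℕ) = v.1 / 2
        · rw [if_pos (by omega), if_pos h]; ring
        · rw [if_neg (by omega), if_neg h]; ring
    simp only [Function.comp_apply, hl]
    rw [Finset.prod_mul_distrib, Finset.prod_const, Finset.card_univ, Fintype.card_fin, ← pow_mul,
      Finset.prod_ite_eq' Finset.univ _ fun _ => β / α, if_pos (Finset.mem_univ _)]
  rw [hprod] at hrest
  refine le_trans ?_ (mul_le_mul hlast hrest (by positivity)
    (blockWeight_nonneg huu hcc hss _ _))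
  have hexp : 2 * s * (L + 1) = (2 * s * (L + 1) - 1) + 1 := by
    have : 1 ≤ 2 * s * (L + 1) := Nat.mul_pos (by omega) (by omega)
    omega
  have hval : (α ^ 2 * β) ^ s * (α ^ (2 * s * L) * (β / α)) =
      α ^ (2 * s * (L + 1) - 1) * β ^ (s + 1) := by
    have : α ^ (2 * s * (L + 1)) = α ^ (2 * s * (L + 1) - 1) * α := by
      conv_lhs => rw [hexp, pow_succ]
    rw [mul_pow, ← pow_mul]
    calc α ^ (2 * s) * β ^ s * (α ^ (2 * s * L) * (β / α))
        = α ^ (2 * s * (L + 1)) * (β ^ (s + 1) / α) := by ring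
      _ = _ := by rw [this]; field_simp
  rw [hval]
  -- As α, β ≤ 1, raising the exponents from the actual locality to `S` only lowers the bound.
  refine mul_le_mul (pow_le_pow_of_le_one hα0.le hα1 ?_)
    (pow_le_pow_of_le_one hβ0.le hβ1 (by omega)) (by positivity) (by positivity)
  exact Nat.sub_le_sub_right (Nat.mul_le_mul_right _ (Nat.mul_le_mul_left _ hiS)) 1

/-! ### Vanishing means -/

/-- Obtained by differentiating `expect_reflect`; the chain rule adds a sign when `v` itself is
reflected. -/
theorem expect_derivWeight_reflect (m : Fin N) (gs : List (Gate N Q)) (hgs : (params gs).Nodup)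
    (hv : v ∈ params gs) (i : Fin N → Fin 4) (θ : Q × Fin N → ℝ) :
    expect (fun k => derivWeight v k (reflect m θ k)) gs i =
      parity (i m) * (if v.2 = m then -1 else 1) *
        expect (fun k => derivWeight v k (θ k)) gs i := by
  have h1 := hasDerivAt_expect gs hgs v hv (reflect m θ) i
  have h2 := hasDerivAt_expect gs hgs v hv θ i
  set ε : ℝ := if v.2 = m then -1 else 1 with hε
  have hεε : ε * ε = 1 := by rw [hε]; split_ifs <;> norm_num
  have hr : reflect m θ v = ε * θ v := by
    simp only [reflect, hε]; split_ifs <;> ring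
  have hfun : (fun t => expect (fun k => trig (Function.update (reflect m θ) v t k)) gs i) =
      fun t => parity (i m) * expect (fun k => trig (Function.update θ v (ε * t) k)) gs i := by
    funext t
    rw [← expect_reflect]
    congr 1
    funext k
    congr 1
    by_cases hk : k = v
    · subst hk
      simp only [Function.update_self, reflect, hε]
      split_ifs <;> ring
    · simp [hk, reflect]
  rw [hfun, hr] at h1
  have h3 : HasDerivAt (fun t : ℝ => ε * t) ε (ε * θ v) := by
    simpa using (hasDerivAt_id (ε * θ v)).const_mul ε
  have h2' : HasDerivAt (fun t => expect (fun k => trig (Function.update θ v t k)) gs i)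
      (expect (fun k => (if k = v then trigDeriv else trig) (θ k)) gs i) (ε * (ε * θ v)) := by
    rwa [← mul_assoc, hεε, one_mul]
  have h4 := (h2'.comp _ h3).const_mul (parity (i m))
  have := h1.unique h4
  simp only [derivWeight]
  rw [this]
  ring

theorem integral_expect_derivWeight_eq_zero [Fintype Q] {a : ℝ} (ha : 0 < a)
    (gs : List (Gate N Q)) (hgs : (params gs).Nodup) (hv : v ∈ params gs) (i : Fin N → Fin 4)
    (hi : countXY i ≠ 1) :
    ∫ θ, expect (fun k => derivWeight v k (θ k)) gs i
      ∂(Measure.pi fun _ : Q × Fin N => angleLaw a) = 0 := by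
  -- The set of X/Y sites is not a singleton, so it differs from {`v.2`}. At a site in exactly one
  -- of the two sets, one of the two signs is -1 and the other is 1.
  obtain ⟨m, hm⟩ : ∃ m, ¬(IsXY (i m) ↔ m = v.2) := by
    by_contra! h
    refine hi (Finset.card_eq_one.2 ⟨v.2, ?_⟩)
    ext m
    rw [Finset.mem_filter, Finset.mem_singleton, ← h m]
    exact and_iff_right (Finset.mem_univ m)
  have hsign : parity (i m) * (if v.2 = m then -1 else 1) = -1 := by
    unfold parity
    by_cases h1 : IsXY (i m) <;> by_cases h2 : v.2 = m <;> simp_all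
  have hmp := measurePreserving_reflect (Q := Q) m ha
  have hint := integral_map (μ := Measure.pi fun _ : Q × Fin N => angleLaw a)
    hmp.measurable.aemeasurable
    (continuous_expect (continuous_derivWeight v) gs i).aestronglyMeasurable
  rw [hmp.map_eq] at hint
  simp only [expect_derivWeight_reflect m gs hgs hv i, hsign, neg_one_mul, integral_neg] at hint
  linarith

end Gate

/-! ### The cost function and its partial derivatives -/

namespace Problem

open Gate

variable {S : ℕ} (V : Problem S)

theorem circuit_eq (θ : V.Index → ℝ) :
    V.circuit θ = ((circuitGates V.layer).map (op θ)).prod := by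
  rw [prod_map_op_circuitGates, circuit]
  congr 3
  funext l
  rw [prod_map_op_block]
  rfl

theorem cost_eq (θ : V.Index → ℝ) :
    V.cost θ = ∑ i ∈ V.terms, expect (fun k => trig (θ k)) (circuitGates V.layer) i := by
  rw [cost, hamiltonian, Finset.sum_mul, Finset.sum_mul, Finset.sum_mul, Matrix.trace_sum,
    Complex.re_sum]
  refine Finset.sum_congr rfl fun i _ => ?_
  rw [circuit_eq, initialState, trace_eq_expect, Complex.ofReal_re]

theorem hasDerivAt_cost (v : V.Index) (θ : V.Index → ℝ) :
    HasDerivAt (fun t => V.cost (Function.update θ v t))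
      (∑ i ∈ V.terms, expect (fun k => derivWeight v k (θ k)) (circuitGates V.layer) i) (θ v) := by
  simp only [cost_eq]
  exact HasDerivAt.fun_sum fun i _ => hasDerivAt_expect _ (nodup_params_circuitGates _) v
    (mem_params_circuitGates _ v) θ i

theorem partialCost_eq (v : V.Index) (θ : V.Index → ℝ) :
    V.partialCost v θ =
      ∑ i ∈ V.terms, expect (fun k => derivWeight v k (θ k)) (circuitGates V.layer) i :=
  (V.hasDerivAt_cost v θ).deriv

theorem initialLaw_eq (a : ℝ) : V.initialLaw a = Measure.pi fun _ => angleLaw a := rfl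

theorem isProbabilityMeasure_initialLaw {a : ℝ} (ha : 0 < a) :
    IsProbabilityMeasure (V.initialLaw a) := by
  have := isProbabilityMeasure_angleLaw ha
  rw [initialLaw_eq]
  infer_instance

theorem memLp_of_continuous {a : ℝ} (ha : 0 < a) {F : (V.Index → ℝ) → ℝ} (hF : Continuous F)
    (p : ENNReal) : MemLp F p (V.initialLaw a) := by
  have := isProbabilityMeasure_angleLaw ha
  exact memLp_pi_of_continuous isCompact_Icc (ae_angleLaw_mem a) hF p

theorem continuous_partialCost (v : V.Index) : Continuous (V.partialCost v) := by
  rw [show V.partialCost v = _ from funext (V.partialCost_eq v)]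
  exact continuous_finsetSum _ fun i _ => continuous_expect (continuous_derivWeight v) _ i

theorem secondMomentPartial_eq {a : ℝ} (ha : 0 < a) (v : V.Index) :
    V.secondMomentPartial a v =
      ∑ i ∈ V.terms, ∑ j ∈ V.terms, derivMoment a v (circuitGates V.layer) i j := by
  have hint : ∀ i j, Integrable (fun θ : V.Index → ℝ =>
      expect (fun k => derivWeight v k (θ k)) (circuitGates V.layer) i *
        expect (fun k => derivWeight v k (θ k)) (circuitGates V.layer) j) (V.initialLaw a) := by
    intro i j
    have := V.isProbabilityMeasure_initialLaw ha
    exact (V.memLp_of_continuous ha ((continuous_expect (continuous_derivWeight v) _ i).mul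
      (continuous_expect (continuous_derivWeight v) _ j)) 1).integrable le_rfl
  simp only [secondMomentPartial, partialCost_eq, pow_two, Finset.sum_mul_sum]
  rw [integral_finsetSum _ fun i _ => integrable_finsetSum _ fun j _ => hint i j]
  refine Finset.sum_congr rfl fun i _ => ?_
  rw [integral_finsetSum _ fun j _ => hint i j]
  refine Finset.sum_congr rfl fun j _ => ?_
  rw [initialLaw_eq]
  exact integral_expect_mul_expect ha v _ (nodup_params_circuitGates _) i j

/-- All entries of the double sum are nonnegative, so it dominates the diagonal entry of one string
acting on the qubit of `v`. -/
theorem secondMomentPartial_ge {a : ℝ} (h0 : 0 < a) (h1 : a < 1) (v : V.Index)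
    (hv : (v.1 : ℕ) + 1 ≤ 2 * V.depth - 2) (hn : V.ActsOn v.2) :
    alphaCoeff a ^ (2 * S * V.depth - 1) * betaCoeff a ^ (S + 1) ≤ V.secondMomentPartial a v := by
  obtain ⟨i, hi, hin⟩ := hn
  rw [V.secondMomentPartial_eq h0]
  have hnn := derivMoment_nonneg h0 h1 v (circuitGates V.layer)
  calc _ ≤ derivMoment a v (circuitGates V.layer) i i :=
        derivMoment_ge h0 h1 V.layer v hv i hin (V.local_terms i hi).2
    _ ≤ ∑ j ∈ V.terms, derivMoment a v (circuitGates V.layer) i j :=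
        Finset.single_le_sum (fun j _ => hnn i j) hi
    _ ≤ _ := Finset.single_le_sum
        (f := fun i => ∑ j ∈ V.terms, derivMoment a v (circuitGates V.layer) i j)
        (fun i _ => Finset.sum_nonneg fun j _ => hnn i j) hi

theorem meanPartial_eq_zero {a : ℝ} (ha : 0 < a) (v : V.Index) (hV : V.NoSingleXY) :
    V.meanPartial a v = 0 := by
  simp only [meanPartial, partialCost_eq]
  have := V.isProbabilityMeasure_initialLaw ha
  rw [integral_finsetSum _ fun i _ => (V.memLp_of_continuous ha
    (continuous_expect (continuous_derivWeight v) _ i) 1).integrable le_rfl]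
  exact Finset.sum_eq_zero fun i hi => integral_expect_derivWeight_eq_zero ha _
    (nodup_params_circuitGates _) (mem_params_circuitGates _ v) i (hV i hi)

theorem variancePartial_eq {a : ℝ} (ha : 0 < a) (v : V.Index) (h : V.meanPartial a v = 0) :
    V.variancePartial a v = V.secondMomentPartial a v := by
  have := V.isProbabilityMeasure_initialLaw ha
  rw [variancePartial, ProbabilityTheory.variance_eq_sub
    (V.memLp_of_continuous ha (V.continuous_partialCost v) 2)]
  rw [meanPartial] at h
  rw [h, zero_pow two_ne_zero, sub_zero]
  rfl

theorem one_le_of_actsOn {n : Fin V.qubits} (hn : V.ActsOn n) : 1 ≤ S := by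
  obtain ⟨i, hi, -⟩ := hn
  exact (V.local_terms i hi).1.trans (V.local_terms i hi).2

theorem secondMomentPartial_ge_of_isSelected {a : ℝ} (ha : IsSelected S V.depth a) (v : V.Index)
    (hv : (v.1 : ℕ) + 1 ≤ 2 * V.depth - 2) (hn : V.ActsOn v.2) :
    (((S : ℝ) + 1) / (Real.exp 1 * (S : ℝ))) ^ (S + 1) *
        (1 / (2 * (V.depth : ℝ) + 1) ^ (S + 1)) ≤ V.secondMomentPartial a v :=
  (ha.le_pow_mul_pow (V.one_le_of_actsOn hn) (by omega)).trans
    (V.secondMomentPartial_ge ha.1 ha.2.1 v hv hn)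

end Problem

end ReducedDomainVQE

/-! ### Assembly of the theorem -/

open ReducedDomainVQE
theorem theorem4 (S : ℕ) :
    -- bounds for a single problem and an arbitrary `a` in `(0,1)`
    (∀ (V : Problem S) (a : ℝ), 0 < a → a < 1 →
      ∀ (q : Fin (2 * V.depth)) (n : Fin V.qubits),
        (∀ θ : V.Index → ℝ,
          DifferentiableAt ℝ (fun t => V.cost (Function.update θ (q, n) t)) (θ (q, n))) ∧
        MemLp (V.partialCost (q, n)) 2 (V.initialLaw a) ∧
        ((q : ℕ) + 1 ≤ 2 * V.depth - 2 → V.ActsOn n →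
          V.secondMomentPartial a (q, n) ≥
            alphaCoeff a ^ (2 * S * V.depth - 1) * betaCoeff a ^ (S + 1)) ∧
        (V.NoSingleXY → V.meanPartial a (q, n) = 0) ∧
        (V.NoSingleXY → (q : ℕ) + 1 ≤ 2 * V.depth - 2 → V.ActsOn n →
          V.variancePartial a (q, n) ≥
            alphaCoeff a ^ (2 * S * V.depth - 1) * betaCoeff a ^ (S + 1)) ∧
        (IsSelected S V.depth a → (q : ℕ) + 1 ≤ 2 * V.depth - 2 → V.ActsOn n →
          V.secondMomentPartial a (q, n) ≥
            (((S : ℝ) + 1) / (Real.exp 1 * (S : ℝ))) ^ (S + 1) *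
              (1 / (2 * (V.depth : ℝ) + 1) ^ (S + 1)))) ∧
    -- the selected `a` exists, is unique, and is of order `1/√L`
    (1 ≤ S →
      (∀ L : ℕ, 2 ≤ L → ∃! a : ℝ, IsSelected S L a) ∧
      ∀ a : ℕ → ℝ, (∀ L : ℕ, 2 ≤ L → IsSelected S L (a L)) →
        a =Θ[atTop] fun L : ℕ => 1 / Real.sqrt (L : ℝ)) ∧
    -- no barren plateau for problems of growing size `m` and depth polynomial in `m`
    (∀ (V : ℕ → Problem S) (m : ℕ → ℕ) (P : Polynomial ℕ) (a : ℕ → ℝ)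
      (q : ∀ k, Fin (2 * (V k).depth)) (n : ∀ k, Fin (V k).qubits),
      Tendsto m atTop atTop →
      (∀ k, (V k).depth ≤ P.eval (m k)) →
      (∀ k, IsSelected S (V k).depth (a k)) →
      (∀ k, (q k : ℕ) + 1 ≤ 2 * (V k).depth - 2) →
      (∀ k, (V k).ActsOn (n k)) →
        PolynomiallyLarge m (fun k => (V k).secondMomentPartial (a k) (q k, n k)) ∧
        ¬ BarrenPlateau m (fun k => (V k).meanPartial (a k) (q k, n k))
            (fun k => (V k).variancePartial (a k) (q k, n k)) ∧
        ((∀ k, (V k).NoSingleXY) →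
          PolynomiallyLarge m (fun k => (V k).variancePartial (a k) (q k, n k)))) := by
  have hpoly : ∀ (V : ℕ → Problem S) (m : ℕ → ℕ) (P : Polynomial ℕ) (a : ℕ → ℝ)
      (q : ∀ k, Fin (2 * (V k).depth)) (n : ∀ k, Fin (V k).qubits), Tendsto m atTop atTop →
      (∀ k, (V k).depth ≤ P.eval (m k)) → (∀ k, IsSelected S (V k).depth (a k)) →
      (∀ k, (q k : ℕ) + 1 ≤ 2 * (V k).depth - 2) → (∀ k, (V k).ActsOn (n k)) →
        PolynomiallyLarge m fun k => (V k).secondMomentPartial (a k) (q k, n k) := by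
    intro V m P a q n hm hP ha hq hn
    have hS : 0 < S := (V 0).one_le_of_actsOn (hn 0)
    have hS' : (0 : ℝ) < S := by exact_mod_cast hS
    exact polynomiallyLarge_of_le hm P hP
      (c := (((S : ℝ) + 1) / (Real.exp 1 * (S : ℝ))) ^ (S + 1)) (by positivity) (S + 1) fun k =>
        (V k).secondMomentPartial_ge_of_isSelected (ha k) (q k, n k) (hq k) (hn k)
  refine ⟨fun V a h0 h1 q n => ⟨fun θ => (V.hasDerivAt_cost (q, n) θ).differentiableAt,
    V.memLp_of_continuous h0 (V.continuous_partialCost (q, n)) 2,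
    V.secondMomentPartial_ge h0 h1 (q, n), V.meanPartial_eq_zero h0 (q, n), fun hV hq hn => ?_,
    fun ha hq hn => V.secondMomentPartial_ge_of_isSelected ha (q, n) hq hn⟩,
    fun hS => ⟨fun L hL => existsUnique_isSelected hS hL, fun a ha => isTheta_of_isSelected hS ha⟩,
    fun V m P a q n hm hP ha hq hn => ⟨hpoly V m P a q n hm hP ha hq hn, ?_, fun hV => ?_⟩⟩
  · rw [V.variancePartial_eq h0 _ (V.meanPartial_eq_zero h0 _ hV)]
    exact V.secondMomentPartial_ge h0 h1 (q, n) hq hn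
  · rintro ⟨hmean, b, hb0, hb1, hb⟩
    -- A barren plateau includes vanishing means, so its variances are second moments, which are
    -- polynomially large.
    simp only [fun k => (V k).variancePartial_eq (ha k).1 _ (hmean k)] at hb
    exact (hpoly V m P a q n hm hP ha hq hn).not_isBigO hm hb0 hb1 hb
  · simp only [fun k => (V k).variancePartial_eq (ha k).1 _
      ((V k).meanPartial_eq_zero (ha k).1 (q k, n k) (hV k))]
    exact hpoly V m P a q n hm hP ha hq hn
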